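/- All graphs are finite and simple. For a positive integer $k$, two proper $k$-colorings $f,f'$ of a graph $G$ are adjacent under color swapping if there is an edge $uv$ of $G$ with $f'(u)=f(v)$, $f'(v)=f(u)$ and $f'(w)=f(w)$ for all other vertices $w$; they are reconfigurable if there is a finite sequence of proper $k$-colorings of $G$ from $f$ to $f'$ in which consecutive colorings are adjacent. An instance $(G,f_s,f_t,k)$ of CRCS consists of a graph $G$, an integer $k\ge 1$ and two proper $k$-colorings $f_s,f_t$ of $G$; it is a yes-instance if $f_s$ and $f_t$ are reconfigurable, and it is valid if $|f_s^{-1}(c)|=|f_t^{-1}(c)|$ for every color $c$. A graph is split if its vertex set can be partitioned into a clique $C$ and an independent set $I$ (either may be empty). Let $(G,f_s,f_t,k)$ be an instance of CRCS in which $G$ is a split graph with such a partition $(C,I)$. Consider two reduction rules. Rule 1 applies to distinct $u,v\in I$ if $N(u)=N(v)$, $f_s(u)=f_s(v)$, and $f_s(u)\ne f_t(u)$ or $f_s(v)\ne f_t(v)$; it answers NO. Rule 2 applies to distinct $u,v,w\in I$ if $N(u)=N(v)=N(w)$ and $f_s(u)=f_s(v)=f_s(w)$; it deletes $w$ from $G$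 and restricts $f_s$ and $f_t$ to the remaining vertices. Theorem. (1) If Rule 1 applies, then the instance is a no-instance. (2) If Rule 1 does not apply to any pair of vertices and Rule 2 applies to $u,v,w$, then the instance produced by Rule 2 is an instance on a split graph with partition $(C,I\setminus\{w\})$, it is valid if the given instance is valid, and it is a yes-instance if and only if the given instance is a yes-instance. (3) CRCS on split graphs, parameterized by the number $k$ of colors, admits a kernel with at most $k+2k\cdot 2^k$ vertices. That is, there is a map computable by a Turing machine in time polynomial in the length of the encoding of the instance (adjacency matrix, and numbers in binary) that transforms every instance $(G,f_s,f_t,k)$ with $G$ split into an equivalent instance $(G',f_s',f_t',k')$ with $G'$ split and $|V(G')|\le k+2k\cdot 2^k$, such that the length of the encoding of the new instance plus $k'$ is at most $h(k)$ for some computable function $h$ independent of the instance. Moreover, this map sends valid instances to valid instances. -/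

import Mathlib

open Computability

universe u

/-- `f` and `f'` are adjacent under color swapping: for some edge `ab` the coloring `f'` arises from
`f` by exchanging the colors of `a` and `b`. (Both colorings being proper, the edge is unique.) -/
def ColorSwapAdj {V : Type u} {G : SimpleGraph V} {k : ℕ} (f f' : G.Coloring (Fin k)) : Prop :=
  ∃ a b : V, G.Adj a b ∧ f a = f' b ∧ f b = f' a ∧ ∀ w : V, w ≠ a → w ≠ b → f w = f' w

/-- There is a finite sequence of proper colorings from `f` to `f'`, consecutive ones being adjacent
under color swapping. -/
def Reconfigurable {V : Type u} {G : SimpleGraph V} {k : ℕ} (f f' : G.Coloring (Fin k)) : Prop :=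
  Relation.ReflTransGen ColorSwapAdj f f'

/-- `C` and `I` partition the vertex set, `C` is a clique and `I` is an independent set
(either part may be empty). -/
structure IsSplitPartition {V : Type u} (G : SimpleGraph V) (C I : Set V) : Prop where
  clique : G.IsClique C
  indep : G.IsIndepSet I
  disjoint : Disjoint C I
  union_eq : C ∪ I = Set.univ

def IsSplitGraph {V : Type u} (G : SimpleGraph V) : Prop :=
  ∃ C I : Set V, IsSplitPartition G C I

/-- An instance `(G, k, f_s, f_t)` of Coloring Reconfiguration under Color Swapping, where `G` has
vertex set `V`. The `k` colors are the elements of `Fin k`. -/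
structure CRCSInstance (V : Type u) where
  graph : SimpleGraph V
  numColors : ℕ
  numColors_pos : 0 < numColors
  source : graph.Coloring (Fin numColors)
  target : graph.Coloring (Fin numColors)

namespace CRCSInstance

variable {V : Type u}

def IsYes (x : CRCSInstance V) : Prop := Reconfigurable x.source x.target

/-- Every color is used equally often in the two colorings. -/
def IsValid (x : CRCSInstance V) : Prop :=
  ∀ c : Fin x.numColors, {v | x.source v = c}.ncard = {v | x.target v = c}.ncard

/-- The instance obtained by removing the vertex `w` and restricting both colorings. -/
def deleteVertex (x : CRCSInstance V) (w : V) : CRCSInstance ↥({w}ᶜ : Set V) where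
  graph := x.graph.induce {w}ᶜ
  numColors := x.numColors
  numColors_pos := x.numColors_pos
  source := x.source.comp (SimpleGraph.Embedding.induce ({w}ᶜ : Set V)).toHom
  target := x.target.comp (SimpleGraph.Embedding.induce ({w}ᶜ : Set V)).toHom

/-- The first reduction rule (return NO) applies to the vertices `a`, `b` of the independent part
`I`: they are twins with the same initial color, one of which changes its color. -/
def Rule1Applies (x : CRCSInstance V) (I : Set V) (a b : V) : Prop :=
  a ∈ I ∧ b ∈ I ∧ a ≠ b ∧ x.graph.neighborSet a = x.graph.neighborSet b ∧
    x.source a = x.source b ∧ (x.source a ≠ x.target a ∨ x.source b ≠ x.target b)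

/-- The second reduction rule (delete `w`) applies to the vertices `a`, `b`, `w` of the independent
part `I`: they are three distinct twins with the same initial color. -/
def Rule2Applies (x : CRCSInstance V) (I : Set V) (a b w : V) : Prop :=
  a ∈ I ∧ b ∈ I ∧ w ∈ I ∧ a ≠ b ∧ a ≠ w ∧ b ≠ w ∧
    x.graph.neighborSet a = x.graph.neighborSet b ∧
    x.graph.neighborSet b = x.graph.neighborSet w ∧
    x.source a = x.source b ∧ x.source b = x.source w

end CRCSInstance

/-- A parameterized problem, with its instances encoded as words over a finite alphabet. -/
structure ParameterizedProblem where
  Instance : Type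
  Alphabet : Type
  [alphabetFintype : Fintype Alphabet]
  encode : Instance → List Alphabet
  encode_injective : Function.Injective encode
  IsYes : Instance → Prop
  parameter : Instance → ℕ

/-- `K` is a kernelization algorithm for `Q`: it is computed by a Turing machine in time polynomial
in the length of the input word, it maps each instance to an equivalent instance of `Q`, and the
size of the output, parameter included, is at most a computable function of the input parameter. -/
structure ParameterizedProblem.IsKernelization (Q : ParameterizedProblem)
    (K : Q.Instance → Q.Instance) : Prop where
  polyTime : Nonempty (Turing.TM2ComputableInPolyTime Q.encode Q.encode K)
  equivalent : ∀ x, Q.IsYes (K x) ↔ Q.IsYes x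
  size_le : ∃ h : ℕ → ℕ, Computable h ∧
    ∀ x, (Q.encode (K x)).length + Q.parameter (K x) ≤ h (Q.parameter x)

/-- An instance of CRCS on a split graph with vertex set `Fin numVertices`. -/
structure SplitCRCSInstance where
  numVertices : ℕ
  toInstance : CRCSInstance (Fin numVertices)
  isSplit : IsSplitGraph toInstance.graph

/-- Concatenation of binary words, each of them followed by the separator `none`. -/
def joinWords (l : List (List Bool)) : List (Option Bool) :=
  l.flatMap fun t => t.map some ++ [none]

theorem joinWords_injective : Function.Injective joinWords := by
  have key : ∀ (s t : List Bool) (p q : List (Option Bool)),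
      s.map some ++ none :: p = t.map some ++ none :: q → s = t ∧ p = q := by
    intro s
    induction s with
    | nil => intro t p q h; cases t <;> simp_all
    | cons a s ih =>
      intro t p q h
      cases t with
      | nil => simp at h
      | cons b t =>
        simp only [List.map_cons, List.cons_append, List.cons.injEq, Option.some.injEq] at h
        obtain ⟨h1, h2⟩ := ih t p q h.2
        exact ⟨by rw [h.1, h1], h2⟩
  intro l
  induction l with
  | nil => intro m h; cases m <;> simp_all [joinWords]
  | cons s l ih =>
    intro m h
    cases m with
    | nil => simp [joinWords] at h
    | cons t m =>
      simp only [joinWords, List.flatMap_cons, List.append_assoc, List.singleton_append] at h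
      obtain ⟨h1, h2⟩ := key _ _ _ _ h
      rw [h1, ih h2]

namespace SplitCRCSInstance

open Classical in
/-- The data of a vertex: its row of the adjacency matrix and its two colors in binary. -/
noncomputable def vertexWords (x : SplitCRCSInstance) (v : Fin x.numVertices) : List (List Bool) :=
  [List.ofFn fun w => decide (x.toInstance.graph.Adj v w),
    encodeNat (x.toInstance.source v), encodeNat (x.toInstance.target v)]

/-- An instance is encoded by the number of colors in binary, followed by the data of each vertex. -/
noncomputable def encode (x : SplitCRCSInstance) : List (Option Bool) :=
  joinWords (encodeNat x.toInstance.numColors :: (List.ofFn x.vertexWords).flatten)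

theorem encodeNat_inj {a b : ℕ} (h : encodeNat a = encodeNat b) : a = b := by
  rw [← decode_encodeNat a, h, decode_encodeNat]

theorem encode_injective : Function.Injective encode := by
  have key : ∀ (l m : List (List (List Bool))), (∀ a ∈ l, a.length = 3) →
      (∀ a ∈ m, a.length = 3) → l.flatten = m.flatten → l = m := by
    intro l
    induction l with
    | nil =>
      intro m _ hm h
      cases m with
      | nil => rfl
      | cons b m =>
        have hb := hm b (by simp)
        have := congrArg List.length h
        simp [hb] at this
        omega
    | cons a l ih =>
      intro m hl hm h
      cases m with
      | nil =>
        have ha := hl a (by simp)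
        have := congrArg List.length h
        simp [ha] at this
      | cons b m =>
        simp only [List.flatten_cons] at h
        obtain ⟨h1, h2⟩ := List.append_inj h ((hl a (by simp)).trans (hm b (by simp)).symm)
        rw [h1, ih m (fun c hc => hl c (by simp [hc])) (fun c hc => hm c (by simp [hc])) h2]
  rintro ⟨n, ⟨G, k, hk, f, g⟩, hx⟩ ⟨n', ⟨G', k', hk', f', g'⟩, hx'⟩ h
  have h := joinWords_injective h
  simp only [List.cons.injEq] at h
  obtain ⟨h1, h2⟩ := h
  have hkk := encodeNat_inj h1
  subst hkk
  have h3 := key _ _ (by simp [List.mem_ofFn, vertexWords]) (by simp [List.mem_ofFn, vertexWords]) h2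
  have hnn : n = n' := by simpa using congrArg List.length h3
  subst hnn
  have h4 := List.ofFn_injective h3
  have h5 : ∀ v, _ := fun v => congrFun h4 v
  simp only [vertexWords, List.cons.injEq, and_true] at h5
  have hG : G = G' := by
    ext v w
    have := congrFun (List.ofFn_injective (h5 v).1) w
    simpa using this
  subst hG
  have hf : f = f' := by
    ext v
    exact encodeNat_inj (h5 v).2.1
  have hg : g = g' := by
    ext v
    exact encodeNat_inj (h5 v).2.2
  subst hf hg
  rfl

end SplitCRCSInstance

/-- CRCS on split graphs, parameterized by the number of colors. -/
noncomputable def splitCRCS : ParameterizedProblem where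
  Instance := SplitCRCSInstance
  Alphabet := Option Bool
  encode := SplitCRCSInstance.encode
  encode_injective := SplitCRCSInstance.encode_injective
  IsYes x := x.toInstance.IsYes
  parameter x := x.toInstance.numColors

/-! Call two vertices twins if they have the same neighbors and the same initial color. Twins are
frozen: if a swap along an edge `aq` changed the color of `a`, then `q` would take over the old
color of `a`, which its other neighbor `b`, the twin of `a`, still has. Hence twins never change
color in a reconfiguration sequence (`Reconfigurable.eq_of_twin`), and an instance in which a twin
must change color is negative. This is the first rule.

If a vertex `w` has two twins `a`, `b` that remain after its deletion, then `w` is frozen, so a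
sequence on the whole graph restricts to the smaller one. Conversely, `a` and `b` are still twins in
the smaller graph and so frozen there; giving `w` its initial color throughout keeps every coloring
proper, because `a` has the same color and the same neighbors. One surviving twin would not do, as
it could move. Both directions are proved for the simultaneous removal of many vertices
(`TwinsKept`, `CRCSInstance.isYes_restrict_iff`), which covers the second rule and the kernel at
once.

The kernel keeps two vertices of each twin class, or outputs a fixed negative instance if some twin
must change color. None of this needs the split partition, so the algorithm does not look for one;
the partition only enters the size bound. The clique has at most `k` vertices, and a vertex of the
independent part is determined, up to twins, by its color and the set of colors of its neighbors,
which leaves at most `k * 2 ^ k` classes of at most two kept vertices.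

For polynomial time, a small language of stack programs is compiled to Turing machines with an exact
step count (`Exec.iterate_step`, `nonempty_polyTime`). A program in this language compares each
vertex with all earlier ones, marks the first two of each class, and prints the marked rows
restricted to the marked columns; `encode_reduced` identifies this output with the encoding of the
induced instance. -/

/-! ### Stack programs and their compilation to Turing machines. -/

/-- Structured programs over a family of stacks indexed by `K` with symbols from `W`: `popCase k f`
pops a symbol `o` from `k` and runs `f o`, and `loop k quit f` repeats this until `quit o` holds. -/
inductive StackProg (K W : Type) : Type
  | skip : StackProg K W
  | push (k : K) (a : W) : StackProg K W
  | seq (p q : StackProg K W) : StackProg K W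
  | popCase (k : K) (f : Option W → StackProg K W) : StackProg K W
  | loop (k : K) (quit : Option W → Bool) (f : Option W → StackProg K W) : StackProg K W

namespace StackProg

variable {K W : Type}

/-- The control states needed for running a program. -/
def Label : StackProg K W → Type
  | skip => Unit
  | push _ _ => Unit
  | seq p q => Label p ⊕ Label q
  | popCase _ f => Option (Σ o, Label (f o))
  | loop _ _ f => Option (Σ o, Label (f o))

/-- The control state in which a program starts. -/
def entry : (p : StackProg K W) → Label p
  | skip => ()
  | push _ _ => ()
  | seq p _ => Sum.inl (entry p)
  | popCase _ _ => none
  | loop _ _ _ => none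

theorem finite_label [Finite W] (p : StackProg K W) : Finite p.Label := by
  induction p with
  | skip => exact inferInstanceAs (Finite Unit)
  | push k a => exact inferInstanceAs (Finite Unit)
  | seq p q hp hq => exact inferInstanceAs (Finite (Label p ⊕ Label q))
  | popCase k f h => exact inferInstanceAs (Finite (Option (Σ o, Label (f o))))
  | loop k s f h => exact inferInstanceAs (Finite (Option (Σ o, Label (f o))))

/-- The code of a program, as a part of a machine whose labels contain those of the program
via `ι`, and which continues at `exit`. The internal state holds the last symbol popped. -/
def toStmt {Λ : Type} : (p : StackProg K W) → (Label p → Λ) → Λ → Label p →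
    Turing.TM2.Stmt (fun _ : K => W) Λ (Option W)
  | skip, _, exit, _ => .goto fun _ => exit
  | push k a, _, exit, _ => .push k (fun _ => a) (.goto fun _ => exit)
  | seq p q, ι, exit, l =>
    match l with
    | Sum.inl l => toStmt p (fun l => ι (Sum.inl l)) (ι (Sum.inr (entry q))) l
    | Sum.inr l => toStmt q (fun l => ι (Sum.inr l)) exit l
  | popCase k f, ι, exit, l =>
    match l with
    | none => .pop k (fun _ o => o) (.goto fun o => ι (some ⟨o, entry (f o)⟩))
    | some ⟨o, l⟩ => toStmt (f o) (fun l => ι (some ⟨o, l⟩)) exit l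
  | loop k quit f, ι, exit, l =>
    match l with
    | none => .pop k (fun _ o => o)
        (.goto fun o => bif quit o then exit else ι (some ⟨o, entry (f o)⟩))
    | some ⟨o, l⟩ => toStmt (f o) (fun l => ι (some ⟨o, l⟩)) (ι none) l

variable [DecidableEq K]

/-- `Exec p S S' t`: started with the stacks `S`, the program `p` terminates after `t` steps with
the stacks `S'`. -/
inductive Exec : StackProg K W → (K → List W) → (K → List W) → ℕ → Prop
  | skip (S) : Exec skip S S 1
  | push (k a S) : Exec (push k a) S (Function.update S k (a :: S k)) 1
  | seq {p q S S' S'' t t'} : Exec p S S' t → Exec q S' S'' t' → Exec (seq p q) S S'' (t + t')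
  | popCase {k f S S' t} : Exec (f (S k).head?) (Function.update S k (S k).tail) S' t →
      Exec (popCase k f) S S' (t + 1)
  | loop_exit {k quit f S} : quit (S k).head? = true →
      Exec (loop k quit f) S (Function.update S k (S k).tail) 1
  | loop_step {k quit f S S' S'' t t'} : quit (S k).head? = false →
      Exec (f (S k).head?) (Function.update S k (S k).tail) S' t →
      Exec (loop k quit f) S' S'' t' → Exec (loop k quit f) S S'' (t + t' + 1)

/-- The machine `M`, the embedding `ι` of labels and the continuation `exit` are arbitrary, since in
the induction each subprogram runs as a part of the machine of the surrounding program. The final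
internal state is left unspecified because every branch is taken right after a pop that overwrites
it. -/
theorem Exec.iterate_step {p : StackProg K W} {S S' : K → List W} {t : ℕ} (h : Exec p S S' t) :
    ∀ {Λ : Type} (M : Λ → Turing.TM2.Stmt (fun _ : K => W) Λ (Option W)) (ι : Label p → Λ)
      (exit : Λ), (∀ l, M (ι l) = toStmt p ι exit l) → ∀ v, ∃ v',
        (flip bind (Turing.TM2.step M))^[t] (some ⟨some (ι (entry p)), v, S⟩) =
          some ⟨some exit, v', S'⟩ := by
  induction h with
  | skip S =>
    intro Λ M ι exit hM v
    exact ⟨v, by simp [flip, hM, toStmt]⟩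
  | push k a S =>
    intro Λ M ι exit hM v
    exact ⟨v, by simp [flip, hM, toStmt]⟩
  | @seq p q S S' S'' t t' _ _ ih1 ih2 =>
    intro Λ M ι exit hM v
    obtain ⟨v1, h1⟩ := ih1 M (fun l => ι (Sum.inl l)) (ι (Sum.inr (entry q)))
      (fun l => hM (Sum.inl l)) v
    obtain ⟨v2, h2⟩ := ih2 M (fun l => ι (Sum.inr l)) exit (fun l => hM (Sum.inr l)) v1
    refine ⟨v2, ?_⟩
    -- `iterate_add_apply` performs the second summand first, hence the exchange.
    rw [add_comm, Function.iterate_add_apply]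
    exact (congrArg _ h1).trans h2
  | @popCase k f S S' t _ ih =>
    intro Λ M ι exit hM v
    obtain ⟨v1, h1⟩ := ih M (fun l => ι (some ⟨_, l⟩)) exit (fun l => hM (some ⟨_, l⟩)) (S k).head?
    refine ⟨v1, ?_⟩
    rw [Function.iterate_succ_apply, ← h1]
    congr 1
    have := hM none
    simp only [toStmt] at this
    simp [flip, entry, this]
  | @loop_exit k quit f S hs =>
    intro Λ M ι exit hM v
    refine ⟨(S k).head?, ?_⟩
    have := hM none
    simp only [toStmt] at this
    simp [flip, entry, this, hs]
  | @loop_step k quit f S S' S'' t t' hs _ _ ih1 ih2 =>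
    intro Λ M ι exit hM v
    obtain ⟨v1, h1⟩ := ih1 M (fun l => ι (some ⟨_, l⟩)) (ι none) (fun l => hM (some ⟨_, l⟩))
      (S k).head?
    obtain ⟨v2, h2⟩ := ih2 M ι exit hM v1
    refine ⟨v2, ?_⟩
    rw [← h2, add_comm t t', add_assoc, Function.iterate_add_apply]
    congr 1
    refine Eq.trans ?_ h1
    rw [Function.iterate_succ_apply]
    congr 1
    have := hM none
    simp only [toStmt] at this
    simp [flip, entry, this, hs]

/-- Started with the stacks `S`, the program `p` terminates within `T` steps with the
stacks `S'`. -/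
def Runs (p : StackProg K W) (S S' : K → List W) (T : ℕ) : Prop :=
  ∃ t ≤ T, Exec p S S' t

/-- A Turing machine running a program, with its input and its output on the stack `k₀`. -/
noncomputable def machine [Fintype K] [Fintype W] (p : StackProg K W) (k₀ : K) :
    Turing.FinTM2 where
  K := K
  k₀ := k₀
  k₁ := k₀
  Γ _ := W
  Λ := Option p.Label
  main := some p.entry
  ΛFin := @Fintype.ofFinite _ (@instFiniteOption _ p.finite_label)
  σ := Option W
  initialState := none
  m
    -- `haltList` requires the initial internal state, so the last popped symbol is erased before
    -- halting.
    | none => .load (fun _ => none) .halt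
    | some l => p.toStmt some none l

theorem initList_eq_update (tm : Turing.FinTM2) (s : List (tm.Γ tm.k₀)) :
    Turing.initList tm s =
      ⟨some tm.main, tm.initialState, Function.update (fun _ => []) tm.k₀ s⟩ := by
  unfold Turing.initList
  congr 1
  funext k
  by_cases hk : k = tm.k₀
  · subst hk; simp
  · simp [hk]

theorem haltList_eq_update (tm : Turing.FinTM2) (s : List (tm.Γ tm.k₁)) :
    Turing.haltList tm s =
      ⟨none, tm.initialState, Function.update (fun _ => []) tm.k₁ s⟩ := by
  unfold Turing.haltList
  congr 1
  funext k
  by_cases hk : k = tm.k₁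
  · subst hk; simp
  · simp [hk]

/-- This reduces polynomial-time computability to a `Runs` statement about stacks. The additional
`1` in the time pays for the halting step. -/
theorem nonempty_polyTime [Fintype K] [Fintype W] {α β : Type} {ea : α → List W}
    {eb : β → List W} {f : α → β} (p : StackProg K W) (k₀ : K) (time : Polynomial ℕ)
    (h : ∀ a, p.Runs (Function.update (fun _ => []) k₀ (ea a))
      (Function.update (fun _ => []) k₀ (eb (f a))) (time.eval (ea a).length)) :
    Nonempty (Turing.TM2ComputableInPolyTime ea eb f) := by
  refine ⟨⟨⟨p.machine k₀, Equiv.refl _, Equiv.refl _⟩, time + 1, fun a => ?_⟩⟩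
  choose t ht hex using h
  have hit := (hex a).iterate_step (p.machine k₀).m some none (fun l => rfl) none
  refine ⟨⟨t a + 1, ?_⟩, by simpa using ht a⟩
  obtain ⟨v, hv⟩ := hit
  have e1 : Turing.initList (p.machine k₀) (List.map (Equiv.refl W).invFun (ea a)) =
      ⟨some (some p.entry), none, Function.update (fun _ => []) k₀ (ea a)⟩ := by
    rw [initList_eq_update]
    exact congrArg (fun l => Turing.TM2.Cfg.mk _ _ (Function.update _ k₀ l)) (List.map_id _)
  have e2 : Turing.haltList (p.machine k₀) (List.map (Equiv.refl W).invFun (eb (f a))) =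
      ⟨none, none, Function.update (fun _ => []) k₀ (eb (f a))⟩ := by
    rw [haltList_eq_update]
    exact congrArg (fun l => Turing.TM2.Cfg.mk _ _ (Function.update _ k₀ l)) (List.map_id _)
  have e3 := congrArg (flip bind (p.machine k₀).step) hv
  refine (Function.iterate_succ_apply' (flip bind (p.machine k₀).step) _ _).trans ?_
  refine (congrArg (fun c => flip bind (p.machine k₀).step
    ((flip bind (p.machine k₀).step)^[t a] (some c))) e1).trans (e3.trans ?_)
  exact (congrArg some e2).symm

end StackProg

/-! ### Rules for running times, and programs that move, copy, read and compare words. -/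

namespace StackProg

variable {K W : Type} [DecidableEq K]

theorem Runs.mono {p : StackProg K W} {S S' : K → List W} {T T' : ℕ} (h : Runs p S S' T)
    (hT : T ≤ T') : Runs p S S' T' := by
  obtain ⟨t, ht, h⟩ := h
  exact ⟨t, ht.trans hT, h⟩

theorem Runs.cast {p : StackProg K W} {S S' S'' : K → List W} {T T' : ℕ} (h : Runs p S S' T)
    (hS : S' = S'') (hT : T ≤ T') : Runs p S S'' T' := hS ▸ h.mono hT

theorem Runs.skip (S : K → List W) : Runs skip S S 1 := ⟨1, le_rfl, .skip S⟩

theorem Runs.push (k : K) (a : W) (S : K → List W) :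
    Runs (push k a) S (Function.update S k (a :: S k)) 1 := ⟨1, le_rfl, .push k a S⟩

theorem Runs.seq {p q : StackProg K W} {S S' S'' : K → List W} {T T' : ℕ} (h : Runs p S S' T)
    (h' : Runs q S' S'' T') : Runs (seq p q) S S'' (T + T') := by
  obtain ⟨t, ht, h⟩ := h
  obtain ⟨t', ht', h'⟩ := h'
  exact ⟨t + t', add_le_add ht ht', .seq h h'⟩

theorem Runs.popCase_nil {k : K} {f : Option W → StackProg K W} {S S' : K → List W} {T : ℕ}
    (hS : S k = []) (h : Runs (f none) S S' T) : Runs (popCase k f) S S' (T + 1) := by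
  obtain ⟨t, ht, h⟩ := h
  refine ⟨t + 1, by omega, .popCase ?_⟩
  have : Function.update S k (S k).tail = S := by
    rw [hS, List.tail_nil, ← hS, Function.update_eq_self]
  rw [this, hS]
  exact h

theorem Runs.popCase_cons {k : K} {f : Option W → StackProg K W} {S S' : K → List W} {T : ℕ}
    {a : W} {l : List W} (hS : S k = a :: l)
    (h : Runs (f (some a)) (Function.update S k l) S' T) : Runs (popCase k f) S S' (T + 1) := by
  obtain ⟨t, ht, h⟩ := h
  refine ⟨t + 1, by omega, .popCase ?_⟩
  rw [hS]
  exact h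

theorem Runs.loop_exit_nil {k : K} {quit : Option W → Bool} {f : Option W → StackProg K W}
    {S : K → List W} (hS : S k = []) (h : quit none = true) : Runs (loop k quit f) S S 1 := by
  have h2 : Exec (loop k quit f) S _ 1 := .loop_exit (by rw [hS]; exact h)
  have : Function.update S k (S k).tail = S := by
    rw [hS, List.tail_nil, ← hS, Function.update_eq_self]
  rw [this] at h2
  exact ⟨1, le_rfl, h2⟩

theorem Runs.loop_exit_cons {k : K} {quit : Option W → Bool} {f : Option W → StackProg K W}
    {S : K → List W} {a : W} {l : List W} (hS : S k = a :: l) (h : quit (some a) = true) :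
    Runs (loop k quit f) S (Function.update S k l) 1 := by
  have h2 : Exec (loop k quit f) S _ 1 := .loop_exit (by rw [hS]; exact h)
  rw [hS] at h2
  exact ⟨1, le_rfl, h2⟩

theorem Runs.loop_step {k : K} {quit : Option W → Bool} {f : Option W → StackProg K W}
    {S S' S'' : K → List W} {T T' : ℕ} {a : W} {l : List W} (hS : S k = a :: l)
    (h : quit (some a) = false) (h1 : Runs (f (some a)) (Function.update S k l) S' T)
    (h2 : Runs (loop k quit f) S' S'' T') : Runs (loop k quit f) S S'' (T + T' + 1) := by
  obtain ⟨t, ht, h1⟩ := h1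
  obtain ⟨t', ht', h2⟩ := h2
  refine ⟨t + t' + 1, by omega, .loop_step (by rw [hS]; exact h) ?_ h2⟩
  rw [hS]
  exact h1

/-- Empty the stack `k`, running `f a` after each symbol `a` popped. -/
def forEach (k : K) (f : W → StackProg K W) : StackProg K W :=
  loop k (fun o => o.isNone) fun o => o.elim skip f

theorem Runs.forEach_nil {k : K} {f : W → StackProg K W} {S : K → List W} (hS : S k = []) :
    Runs (forEach k f) S S 1 := .loop_exit_nil hS rfl

theorem Runs.forEach_cons {k : K} {f : W → StackProg K W} {S S' S'' : K → List W} {T T' : ℕ}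
    {a : W} {l : List W} (hS : S k = a :: l) (h1 : Runs (f a) (Function.update S k l) S' T)
    (h2 : Runs (forEach k f) S' S'' T') : Runs (forEach k f) S S'' (T + T' + 1) :=
  .loop_step hS rfl h1 h2

/-- Empty the stack `k`. -/
def clear (k : K) : StackProg K W := forEach k fun _ => skip

theorem runs_clear (k : K) (S : K → List W) :
    Runs (clear k) S (Function.update S k []) (2 * (S k).length + 1) := by
  generalize hl : S k = l
  induction l generalizing S with
  | nil =>
    refine (Runs.forEach_nil hl).cast ?_ (by simp)
    rw [← hl, Function.update_eq_self]
  | cons a l ih =>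
    refine (Runs.forEach_cons hl (.skip _) (ih (Function.update S k l) (by simp))).cast
      (by simp) (by simp; omega)

/-- Move the content of `k` to `m`, reversing it. -/
def move (k m : K) : StackProg K W := forEach k fun a => push m a

theorem runs_move {k m : K} (hkm : k ≠ m) (S : K → List W) :
    Runs (move k m) S (Function.update (Function.update S k []) m ((S k).reverse ++ S m))
      (2 * (S k).length + 1) := by
  generalize hl : S k = l
  induction l generalizing S with
  | nil =>
    refine (Runs.forEach_nil hl).cast ?_ (by simp)
    rw [← hl, Function.update_eq_self]
    simp [hl]
  | cons a l ih =>
    refine (Runs.forEach_cons hl (.push _ _ _) (ih _ ?_)).cast ?_ ?_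
    · simp [hkm]
    rotate_left
    · simp; omega
    funext x
    by_cases h1 : x = m
    · subst h1; simp [hkm.symm]
    by_cases h2 : x = k
    · subst h2; simp [h1]
    · simp [h1, h2]

/-- Move the content of `k` to each of `m` and `n`, reversing it. -/
def moveTwo (k m n : K) : StackProg K W := forEach k fun a => seq (push m a) (push n a)

theorem runs_moveTwo {k m n : K} (hkm : k ≠ m) (hkn : k ≠ n) (hmn : m ≠ n) (S : K → List W) :
    Runs (moveTwo k m n) S (Function.update (Function.update (Function.update S k [])
      m ((S k).reverse ++ S m)) n ((S k).reverse ++ S n)) (3 * (S k).length + 1) := by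
  generalize hl : S k = l
  induction l generalizing S with
  | nil =>
    refine (Runs.forEach_nil hl).cast ?_ (by simp)
    rw [← hl, Function.update_eq_self]
    simp [hl]
  | cons a l ih =>
    refine (Runs.forEach_cons hl ((Runs.push _ _ _).seq (.push _ _ _)) (ih _ ?_)).cast ?_ ?_
    · simp [hkm, hkn]
    rotate_left
    · simp; omega
    funext x
    by_cases h1 : x = m
    · subst h1; simp [hkm.symm, hmn]
    by_cases h2 : x = k
    · subst h2; simp [h1, hkn]
    by_cases h3 : x = n
    · subst h3; simp [h1, h2]
    · simp [h1, h2, h3]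

/-- Copy the content of `k` to `m`, using the empty stack `t`. -/
def copy (k m t : K) : StackProg K W := seq (move k t) (moveTwo t k m)

theorem runs_copy {k m t : K} (hkm : k ≠ m) (hkt : k ≠ t) (hmt : m ≠ t) (S : K → List W)
    (ht : S t = []) :
    Runs (copy k m t) S (Function.update S m (S k ++ S m)) (5 * (S k).length + 2) := by
  have h := (runs_move hkt S).seq (runs_moveTwo hkt.symm hmt.symm hkm _)
  refine h.cast ?_ (by simp [ht]; omega)
  funext x
  by_cases h1 : x = m
  · subst h1; simp [hmt, hkm.symm, ht]
  by_cases h2 : x = k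
  · subst h2; simp [h1, hkt, ht]
  by_cases h3 : x = t
  · subst h3; simp [h1, h2, ht]
  · simp [h1, h2, h3]

/-- Copy the content of `k` to `m`, reversing it, using the empty stack `t`. -/
def copyReverse (k m t : K) : StackProg K W := seq (moveTwo k t m) (move t k)

theorem runs_copyReverse {k m t : K} (hkm : k ≠ m) (hkt : k ≠ t) (hmt : m ≠ t) (S : K → List W)
    (ht : S t = []) :
    Runs (copyReverse k m t) S (Function.update S m ((S k).reverse ++ S m))
      (5 * (S k).length + 2) := by
  have h := (runs_moveTwo hkt hkm hmt.symm S).seq (runs_move hkt.symm _)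
  refine h.cast ?_ (by simp [ht, hmt.symm]; omega)
  funext x
  by_cases h1 : x = m
  · subst h1; simp [hmt, hkm.symm]
  by_cases h2 : x = k
  · subst h2; simp [h1, hkt, ht, hmt.symm]
  by_cases h3 : x = t
  · subst h3; simp [h1, h2, ht]
  · simp [h1, h2, h3]

/-- Push the symbols of `l`, the last one first. -/
def pushAll (k : K) : List W → StackProg K W
  | [] => skip
  | a :: l => seq (pushAll k l) (push k a)

theorem runs_pushAll (k : K) (l : List W) (S : K → List W) :
    Runs (pushAll k l) S (Function.update S k (l ++ S k)) (l.length + 1) := by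
  induction l with
  | nil => simpa [pushAll] using Runs.skip S
  | cons a l ih =>
    exact (ih.seq (.push k a _)).cast (by simp) (by simp)

/-- Run `p` for as long as the stack `k` is nonempty. -/
def whileNonempty (k : K) (p : StackProg K W) : StackProg K W :=
  forEach k fun a => seq (push k a) p

theorem Runs.whileNonempty_nil {k : K} {p : StackProg K W} {S : K → List W} (hS : S k = []) :
    Runs (whileNonempty k p) S S 1 := .forEach_nil hS

theorem Runs.whileNonempty_cons {k : K} {p : StackProg K W} {S S' S'' : K → List W} {T T' : ℕ}
    (hS : S k ≠ []) (h1 : Runs p S S' T) (h2 : Runs (whileNonempty k p) S' S'' T') :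
    Runs (whileNonempty k p) S S'' (T + T' + 2) := by
  obtain ⟨a, l, hl⟩ := List.exists_cons_of_ne_nil hS
  refine (Runs.forEach_cons (T := 1 + T) hl ((Runs.push _ _ _).seq (S'' := S') ?_) h2).mono
    (by omega)
  simpa [← hl] using h1

/-- Move the first word of `k`, up to the separator `none`, to `m`, reversing it. -/
def readWord (k m : K) : StackProg K (Option Bool) :=
  loop k (fun o => o.join.isNone) fun o => o.elim skip (push m)

theorem runs_readWord {k m : K} (hkm : k ≠ m) (S : K → List (Option Bool)) (w : List Bool)
    (r : List (Option Bool)) (hS : S k = w.map some ++ none :: r) :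
    Runs (readWord k m) S
      (Function.update (Function.update S k r) m (w.reverse.map some ++ S m))
      (2 * w.length + 1) := by
  induction w generalizing S with
  | nil =>
    simp only [List.map_nil, List.nil_append] at hS
    exact (Runs.loop_exit_cons hS rfl).cast (by simp [hkm.symm]) le_rfl
  | cons a w ih =>
    refine (Runs.loop_step hS rfl (.push _ _ _) (ih _ ?_)).cast ?_ ?_
    · simp [hkm]
    rotate_left
    · simp; omega
    funext x
    by_cases h1 : x = m
    · subst h1; simp [hkm.symm]
    by_cases h2 : x = k
    · subst h2; simp [h1]
    · simp [h1, h2]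

/-- Compare the first word of `k` with the content of `m`, deleting both of them, and push a
symbol on `n` if they differ. -/
def compareWord (k m n : K) : StackProg K (Option Bool) :=
  seq (loop k (fun o => o.join.isNone) fun o =>
      popCase m fun o' => if o = o' then skip else push n none)
    (forEach m fun _ => push n none)

theorem runs_forEach_push {m n : K} (hmn : m ≠ n) (a : W) (S : K → List W) :
    Runs (forEach m fun _ => push n a) S (Function.update (Function.update S m []) n
      (List.replicate (S m).length a ++ S n)) (2 * (S m).length + 1) := by
  generalize hl : S m = l
  induction l generalizing S with
  | nil =>
    refine (Runs.forEach_nil hl).cast ?_ (by simp)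
    rw [← hl, Function.update_eq_self]
    simp [hl]
  | cons b l ih =>
    refine (Runs.forEach_cons hl (.push n a _) (ih _ ?_)).cast ?_ ?_
    · simp [hmn]
    rotate_left
    · simp; omega
    funext x
    by_cases h1 : x = n
    · subst h1; simp [hmn.symm, List.replicate_succ']
    by_cases h2 : x = m
    · subst h2; simp [h1]
    · simp [h1, h2]

/-- Instead of a truth value the program leaves `d` symbols, one for each mismatch, so that the
results of several comparisons can accumulate on one stack; only whether `d` vanishes matters. -/
theorem runs_compareWord {k m n : K} (hkm : k ≠ m) (hkn : k ≠ n) (hmn : m ≠ n)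
    (S : K → List (Option Bool)) (w u : List Bool) (r : List (Option Bool))
    (hk : S k = w.map some ++ none :: r) (hm : S m = u.map some) :
    ∃ d : ℕ, d ≤ w.length + u.length ∧ (d = 0 ↔ w = u) ∧
      Runs (compareWord k m n) S (Function.update (Function.update (Function.update S k r) m [])
        n (List.replicate d none ++ S n)) (3 * w.length + 2 * u.length + 2) := by
  -- The loop stops at the separator, when a remainder `u'` may be left on `m`; its symbols are then
  -- counted as mismatches too.
  suffices H : ∃ (d : ℕ) (u' : List Bool), d ≤ w.length ∧ u'.length ≤ u.length ∧
      (d = 0 ∧ u' = [] ↔ w = u) ∧ Runs (loop k (fun o => o.join.isNone) fun o =>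
        popCase m fun o' => if o = o' then StackProg.skip else StackProg.push n none) S
        (Function.update (Function.update (Function.update S k r) m (u'.map some))
          n (List.replicate d none ++ S n)) (3 * w.length + 1) by
    obtain ⟨d, u', hd, hu, hdu, H⟩ := H
    refine ⟨u'.length + d, by omega, ?_, ?_⟩
    · rw [← hdu, Nat.add_eq_zero_iff, List.length_eq_zero_iff, and_comm]
    · refine (H.seq (runs_forEach_push hmn none _)).cast ?_ (by simp [hmn]; omega)
      funext x
      by_cases e1 : x = n
      · subst e1; simp [hmn, ← List.append_assoc, List.replicate_append_replicate]
      by_cases e2 : x = m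
      · subst e2; simp [e1]
      · simp [e1, e2]
  induction w generalizing S u with
  | nil =>
    simp only [List.map_nil, List.nil_append] at hk
    refine ⟨0, u, by simp, le_rfl, by simp [eq_comm],
      (Runs.loop_exit_cons hk rfl).cast ?_ le_rfl⟩
    funext x
    by_cases e1 : x = n
    · subst e1; simp [hkn.symm]
    by_cases e2 : x = m
    · subst e2; simp [e1, hm, hkm.symm]
    · simp [e1, e2]
  | cons a w ih =>
    cases u with
    | nil =>
      -- With `m` exhausted the inner pop yields `none`, which differs from the symbol read and so
      -- counts as a mismatch.
      obtain ⟨d, u', hd, hu, hdu, H⟩ := ih (Function.update (Function.update S k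
        (w.map some ++ none :: r)) n (none :: S n)) [] (by simp [hkn]) (by simp [hm, hmn, hkm.symm])
      refine ⟨d + 1, u', by simpa using hd, by simpa using hu, by simp, ?_⟩
      have h1 : Runs (popCase m fun o' => if some (some a) = o' then StackProg.skip else
          StackProg.push n none) (Function.update S k (w.map some ++ none :: r)) _ _ :=
        .popCase_nil (by simp [hm, hkm.symm]) (by simpa using Runs.push n none _)
      refine (Runs.loop_step hk rfl h1 ?_ (T' := 3 * w.length + 1)).mono (by simp; omega)
      refine Runs.cast (by simpa [hkn.symm, hmn.symm] using H) ?_ le_rfl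
      funext x
      by_cases e1 : x = n
      · subst e1; simp [List.replicate_succ']
      by_cases e2 : x = m
      · subst e2; simp [e1]
      by_cases e3 : x = k
      · subst e3; simp [e1, e2]
      · simp [e1, e2, e3]
    | cons b u =>
      by_cases hab : a = b
      · obtain ⟨d, u', hd, hu, hdu, H⟩ := ih (Function.update (Function.update S k
          (w.map some ++ none :: r)) m (u.map some)) u (by simp [hkm]) (by simp)
        refine ⟨d, u', by simp; omega, by simp; omega, by simp [hdu, hab], ?_⟩
        have h1 : Runs (popCase m fun o' => if some (some a) = o' then StackProg.skip else
            StackProg.push n none) (Function.update S k (w.map some ++ none :: r)) _ _ :=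
          .popCase_cons (a := some b) (l := u.map some) (by simp [hm, hkm.symm])
            (by simpa [hab] using Runs.skip _)
        refine (Runs.loop_step hk rfl h1 ?_ (T' := 3 * w.length + 1)).mono (by simp; omega)
        refine Runs.cast (by simpa [hkn.symm, hmn.symm] using H) ?_ le_rfl
        funext x
        by_cases e1 : x = n
        · subst e1; simp
        by_cases e2 : x = m
        · subst e2; simp [e1]
        by_cases e3 : x = k
        · subst e3; simp [e1, e2]
        · simp [e1, e2, e3]
      · obtain ⟨d, u', hd, hu, hdu, H⟩ := ih (Function.update (Function.update (Function.update S k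
          (w.map some ++ none :: r)) m (u.map some)) n (none :: S n)) u (by simp [hkm, hkn])
          (by simp [hmn])
        refine ⟨d + 1, u', by simp; omega, by simp; omega, by simp [hab], ?_⟩
        have h1 : Runs (popCase m fun o' => if some (some a) = o' then StackProg.skip else
            StackProg.push n none) (Function.update S k (w.map some ++ none :: r)) _ _ :=
          .popCase_cons (a := some b) (l := u.map some) (by simp [hm, hkm.symm])
            (by simpa [hab] using Runs.push n none _)
        refine (Runs.loop_step hk rfl h1 ?_ (T' := 3 * w.length + 1)).mono (by simp; omega)
        refine Runs.cast (by simpa [hkn.symm, hmn.symm] using H) ?_ le_rfl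
        funext x
        by_cases e1 : x = n
        · subst e1; simp [List.replicate_succ']
        by_cases e2 : x = m
        · subst e2; simp [e1]
        by_cases e3 : x = k
        · subst e3; simp [e1, e2]
        · simp [e1, e2, e3]

end StackProg

/-! ### The stacks of the kernelization machine. -/

/-- The names of the stacks of the kernelization machine. -/
inductive Stk : Type
  | inp | out | prev | scan | row | src | tmp | aux | neq | neqTgt | cnt | chg | bad | mask
  deriving DecidableEq

instance : Fintype Stk where
  elems := {.inp, .out, .prev, .scan, .row, .src, .tmp, .aux, .neq, .neqTgt, .cnt, .chg, .bad, .mask}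
  complete k := by cases k <;> decide

/-- The contents of the stacks of the kernelization machine. -/
structure Stacks where
  inp : List (Option Bool) := []
  out : List (Option Bool) := []
  prev : List (Option Bool) := []
  scan : List (Option Bool) := []
  row : List (Option Bool) := []
  src : List (Option Bool) := []
  tmp : List (Option Bool) := []
  aux : List (Option Bool) := []
  neq : List (Option Bool) := []
  neqTgt : List (Option Bool) := []
  cnt : List (Option Bool) := []
  chg : List (Option Bool) := []
  bad : List (Option Bool) := []
  mask : List (Option Bool) := []

namespace Stacks

@[simp] def get (s : Stacks) : Stk → List (Option Bool)
  | .inp => s.inp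
  | .out => s.out
  | .prev => s.prev
  | .scan => s.scan
  | .row => s.row
  | .src => s.src
  | .tmp => s.tmp
  | .aux => s.aux
  | .neq => s.neq
  | .neqTgt => s.neqTgt
  | .cnt => s.cnt
  | .chg => s.chg
  | .bad => s.bad
  | .mask => s.mask

@[simp] def set (s : Stacks) (k : Stk) (l : List (Option Bool)) : Stacks :=
  match k with
  | .inp => { s with inp := l }
  | .out => { s with out := l }
  | .prev => { s with prev := l }
  | .scan => { s with scan := l }
  | .row => { s with row := l }
  | .src => { s with src := l }
  | .tmp => { s with tmp := l }
  | .aux => { s with aux := l }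
  | .neq => { s with neq := l }
  | .neqTgt => { s with neqTgt := l }
  | .cnt => { s with cnt := l }
  | .chg => { s with chg := l }
  | .bad => { s with bad := l }
  | .mask => { s with mask := l }

@[simp] theorem update_get (s : Stacks) (k : Stk) (l : List (Option Bool)) :
    Function.update s.get k l = (s.set k l).get := by
  funext m
  cases k <;> cases m <;> simp [Function.update]

end Stacks

/-! ### Vertex records and the list functions computed by the machine. -/

/-- The data of a vertex in the encoding of an instance. -/
structure VertexRecord where
  row : List Bool
  source : List Bool
  target : List Bool

namespace VertexRecord

def words (r : VertexRecord) : List (List Bool) := [r.row, r.source, r.target]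

def encodeList (L : List VertexRecord) : List (Option Bool) := joinWords (L.flatMap words)

@[simp] theorem encodeList_nil : encodeList [] = [] := rfl

@[simp] theorem encodeList_cons (r : VertexRecord) (L : List VertexRecord) :
    encodeList (r :: L) = r.row.map some ++ none :: (r.source.map some ++ none ::
      (r.target.map some ++ none :: encodeList L)) := by
  simp [encodeList, joinWords, words]

theorem encodeList_append (L M : List VertexRecord) :
    encodeList (L ++ M) = encodeList L ++ encodeList M := by
  simp [encodeList, joinWords]

/-- The number of symbols encoding the data of a vertex. -/
def size (r : VertexRecord) : ℕ := r.row.length + r.source.length + r.target.length + 3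

theorem length_encodeList_cons (r : VertexRecord) (L : List VertexRecord) :
    (encodeList (r :: L)).length = r.size + (encodeList L).length := by
  simp [size]; omega

theorem length_le_length_encodeList (L : List VertexRecord) :
    L.length ≤ (encodeList L).length := by
  induction L with
  | nil => simp
  | cons r L ih => rw [length_encodeList_cons, List.length_cons, size]; omega

/-- Two vertices have the same neighbors and the same initial color. -/
def twin (r w : VertexRecord) : Bool := decide (w.row = r.row ∧ w.source = r.source)

/-- `w` is a twin of `r` whose final color is not the common initial color. -/
def changedTwin (r w : VertexRecord) : Bool := r.twin w && decide (w.target ≠ r.source)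

theorem twin_self (r : VertexRecord) : r.twin r = true := by simp [twin]

/-- For a list of vertices, the latest one first, mark those with fewer than two earlier twins. -/
def marks : List VertexRecord → List Bool
  | [] => []
  | r :: L => decide (L.countP r.twin < 2) :: marks L

/-- The number of vertices having an earlier twin, and a twin, possibly the vertex itself, changing
its color. -/
def badCount : List VertexRecord → ℕ
  | [] => 0
  | r :: L => (if 1 ≤ L.countP r.twin ∧ 0 < (r :: L).countP r.changedTwin then 1 else 0) +
      badCount L

end VertexRecord

/-- The entries of a list that are marked by a second list. -/
def selectMarked {α : Type*} : List α → List Bool → List α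
  | a :: u, b :: m => if b then a :: selectMarked u m else selectMarked u m
  | _, _ => []

namespace VertexRecord

/-- The marked vertices of the list `L`, in reverse order, with their rows restricted to the
columns marked in `m`. -/
def restrictMarked (m : List Bool) : List VertexRecord → List Bool → List VertexRecord
  | r :: L, b :: c => restrictMarked m L c ++
      if b then [⟨(selectMarked r.row.reverse m).reverse, r.source, r.target⟩] else []
  | _, _ => []

end VertexRecord

/-! ### The kernelization program and its running time. -/

namespace KernelProg

open StackProg VertexRecord

theorem runs_push_get (k : Stk) (a : Option Bool) (s : Stacks) :
    Runs (push k a) s.get (s.set k (a :: s.get k)).get 1 := by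
  simpa only [Stacks.update_get] using Runs.push k a s.get

/-- Compare the next vertex on `scan` with the one stored on `row` and `src`, and count it on `cnt`
if it is a twin, and also on `chg` if it changes its color. -/
def scanVertex : StackProg Stk (Option Bool) :=
  seq (copyReverse .row .tmp .aux) <| seq (compareWord .scan .tmp .neq) <|
  seq (copyReverse .src .tmp .aux) <| seq (compareWord .scan .tmp .neq) <|
  seq (copyReverse .src .tmp .aux) <| seq (compareWord .scan .tmp .neqTgt) <|
  popCase .neq fun o => o.elim
    (seq (push .cnt none) (popCase .neqTgt fun o => o.elim skip fun _ =>
      seq (push .chg none) (clear .neqTgt)))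
    (fun _ => seq (clear .neq) (clear .neqTgt))

/-- Mismatches of rows and of initial colors both go to `neq`, which is therefore empty exactly for
twins. The final color of `w` can be compared with the initial color of `r`, because only twins,
which share that color, are counted. The stored words are reversed, and `copyReverse` restores their
reading order. -/
theorem runs_scanVertex (s : Stacks) (r w : VertexRecord) (l : List (Option Bool)) (N : ℕ)
    (hr : r.size ≤ N) (hw : w.size ≤ N) (hscan : s.scan = encodeList [w] ++ l)
    (hrow : s.row = r.row.reverse.map some) (hsrc : s.src = r.source.reverse.map some)
    (htmp : s.tmp = []) (haux : s.aux = []) (hneq : s.neq = []) (hneqTgt : s.neqTgt = []) :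
    Runs scanVertex s.get { s with
      scan := l
      cnt := if r.twin w then none :: s.cnt else s.cnt
      chg := if r.changedTwin w then none :: s.chg else s.chg }.get (50 * (N + 1)) := by
  obtain ⟨inp, out, prev, scan, row, src, tmp, aux, neq, neqTgt, cnt, chg, bad, mask⟩ := s
  simp only at hscan hrow hsrc htmp haux hneq hneqTgt
  subst hscan hrow hsrc htmp haux hneq hneqTgt
  simp only [encodeList_cons, encodeList_nil, List.append_assoc, List.cons_append, List.nil_append]
  rw [size] at hr hw
  have h1 := runs_copyReverse (k := Stk.row) (m := .tmp) (t := .aux) (by decide) (by decide)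
    (by decide) _ (show Stacks.get ⟨inp, out, prev, w.row.map some ++ none ::
      (w.source.map some ++ none :: (w.target.map some ++ none :: l)), r.row.reverse.map some,
      r.source.reverse.map some, [], [], [], [], cnt, chg, bad, mask⟩ .aux = [] from rfl)
  simp at h1
  obtain ⟨d1, hd1, hdw1, h2⟩ := runs_compareWord (k := Stk.scan) (m := .tmp) (n := .neq)
    (by decide) (by decide) (by decide) (Stacks.get ⟨inp, out, prev, w.row.map some ++ none ::
      (w.source.map some ++ none :: (w.target.map some ++ none :: l)), r.row.reverse.map some,
      r.source.reverse.map some, r.row.map some, [], [], [], cnt, chg, bad, mask⟩) w.row r.row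
      _ rfl rfl
  simp at h2
  have h3 := runs_copyReverse (k := Stk.src) (m := .tmp) (t := .aux) (by decide) (by decide)
    (by decide) _ (show Stacks.get ⟨inp, out, prev, (w.source.map some ++ none ::
      (w.target.map some ++ none :: l)), r.row.reverse.map some,
      r.source.reverse.map some, [], [], List.replicate d1 none, [], cnt, chg, bad, mask⟩ .aux = []
      from rfl)
  simp at h3
  obtain ⟨d2, hd2, hdw2, h4⟩ := runs_compareWord (k := Stk.scan) (m := .tmp) (n := .neq)
    (by decide) (by decide) (by decide) (Stacks.get ⟨inp, out, prev,
      (w.source.map some ++ none :: (w.target.map some ++ none :: l)), r.row.reverse.map some,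
      r.source.reverse.map some, r.source.map some, [], List.replicate d1 none, [], cnt, chg, bad,
      mask⟩) w.source r.source _ rfl rfl
  simp at h4
  have h5 := runs_copyReverse (k := Stk.src) (m := .tmp) (t := .aux) (by decide) (by decide)
    (by decide) _ (show Stacks.get ⟨inp, out, prev, (w.target.map some ++ none :: l),
      r.row.reverse.map some, r.source.reverse.map some, [], [], List.replicate (d2 + d1) none, [],
      cnt, chg, bad, mask⟩ .aux = [] from rfl)
  simp at h5
  obtain ⟨d3, hd3, hdw3, h6⟩ := runs_compareWord (k := Stk.scan) (m := .tmp) (n := .neqTgt)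
    (by decide) (by decide) (by decide) (Stacks.get ⟨inp, out, prev,
      (w.target.map some ++ none :: l), r.row.reverse.map some,
      r.source.reverse.map some, r.source.map some, [], List.replicate (d2 + d1) none, [],
      cnt, chg, bad, mask⟩) w.target r.source _ rfl rfl
  simp at h6
  simp only [List.map_reverse]
  -- The remaining budget pays for emptying the two mismatch stacks.
  refine Runs.mono (h1.seq (h2.seq (h3.seq (h4.seq (h5.seq (h6.seq
    (?_ : Runs _ _ _ (2 * (d1 + d2) + 2 * d3 + 5)))))))) (by omega)
  by_cases ht : r.twin w = true
  · have ht' := ht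
    simp only [twin, decide_eq_true_eq] at ht'
    have e1 : d1 = 0 := hdw1.2 ht'.1
    have e2 : d2 = 0 := hdw2.2 ht'.2
    subst e1 e2
    refine Runs.mono (.popCase_nil (by simp) ((Runs.push _ _ _).seq
      (?_ : Runs _ _ _ (2 * d3 + 3)))) (by omega)
    simp only [Stacks.update_get, Stacks.set]
    rcases d3 with _ | d3
    · have : w.target = r.source := hdw3.1 rfl
      refine Runs.cast (.popCase_nil (by simp) (.skip _)) ?_ (by omega)
      simp [ht, changedTwin, this]
    · have : w.target ≠ r.source := fun h => by simpa using hdw3.2 h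
      refine Runs.cast (.popCase_cons (a := none) (l := List.replicate d3 none)
        (by simp [List.replicate_succ]) ((Runs.push _ _ _).seq (runs_clear _ _))) ?_
        (by simp; omega)
      simp [ht, changedTwin, this]
  · obtain ⟨d, hd⟩ : ∃ d, d2 + d1 = d + 1 := by
      refine Nat.exists_eq_succ_of_ne_zero fun h => ht ?_
      simp only [twin, decide_eq_true_eq]
      exact ⟨hdw1.1 (by omega), hdw2.1 (by omega)⟩
    rw [hd]
    refine Runs.cast (.popCase_cons (a := none) (l := List.replicate d none)
      (by simp [List.replicate_succ]) ((runs_clear _ _).seq (runs_clear _ _))) ?_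
      (by simp; omega)
    simp [ht, changedTwin]

theorem runs_scan (L : List VertexRecord) (s : Stacks) (r : VertexRecord) (N : ℕ)
    (hr : r.size ≤ N) (hL : (encodeList L).length ≤ N) (hscan : s.scan = encodeList L)
    (hrow : s.row = r.row.reverse.map some) (hsrc : s.src = r.source.reverse.map some)
    (htmp : s.tmp = []) (haux : s.aux = []) (hneq : s.neq = []) (hneqTgt : s.neqTgt = []) :
    Runs (whileNonempty .scan scanVertex) s.get { s with
      scan := []
      cnt := List.replicate (L.countP r.twin) none ++ s.cnt
      chg := List.replicate (L.countP r.changedTwin) none ++ s.chg }.get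
      (L.length * (50 * (N + 1) + 2) + 1) := by
  induction L generalizing s with
  | nil =>
    refine (Runs.whileNonempty_nil (by simpa using hscan)).cast ?_ (by simp)
    obtain ⟨inp, out, prev, scan, row, src, tmp, aux, neq, neqTgt, cnt, chg, bad, mask⟩ := s
    simp only [encodeList_nil] at hscan
    simp [hscan]
  | cons w L ih =>
    rw [length_encodeList_cons] at hL
    have h1 := runs_scanVertex s r w (encodeList L) N hr (by omega) (by simp [hscan]) hrow hsrc htmp
      haux hneq hneqTgt
    have h2 := ih { s with
      scan := encodeList L
      cnt := if r.twin w then none :: s.cnt else s.cnt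
      chg := if r.changedTwin w then none :: s.chg else s.chg } (by omega) rfl hrow hsrc htmp
      haux hneq hneqTgt
    refine (Runs.whileNonempty_cons (by simp [hscan]) h1 h2).cast ?_
      (by simp only [List.length_cons]; ring_nf; omega)
    -- The counters hold copies of one symbol, so pushing before the later symbols or after them
    -- gives the same stack.
    have key : ∀ (b : Bool) (n : ℕ) (l : List (Option Bool)),
        (List.replicate n none ++ if b = true then none :: l else l) =
          List.replicate (n + if b = true then 1 else 0) none ++ l := by
      intro b n l
      cases b <;> simp [List.replicate_succ']
    simp only [List.countP_cons, key]

/-- Use the number of twins counted on `cnt` for deciding whether a vertex is kept. -/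
def classify : StackProg Stk (Option Bool) :=
  popCase .cnt fun _ => popCase .cnt fun o => o.elim
    (seq (clear .chg) (push .mask (some true)))
    (fun _ => seq
      (popCase .chg fun o => o.elim skip fun _ => seq (push .bad none) (clear .chg))
      (popCase .cnt fun o => o.elim (push .mask (some true)) fun _ =>
        seq (clear .cnt) (push .mask (some false))))

/-- The counter is `c + 1` because a vertex is scanned against itself as well; the first pop
discards this symbol, and the next two distinguish `c = 0`, `c = 1` and `c ≥ 2`. -/
theorem runs_classify (s : Stacks) (c b : ℕ) (hc : s.cnt = List.replicate (c + 1) none)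
    (hb : s.chg = List.replicate b none) :
    Runs classify s.get { s with
      cnt := []
      chg := []
      bad := if 1 ≤ c ∧ 0 < b then none :: s.bad else s.bad
      mask := some (decide (c < 2)) :: s.mask }.get (2 * c + 2 * b + 10) := by
  refine Runs.mono (.popCase_cons (a := none) (l := List.replicate c none)
    (by simp [hc, List.replicate_succ]) (?_ : Runs _ _ _ (2 * c + 2 * b + 8))) (by omega)
  rcases c with _ | c
  · refine Runs.cast (.popCase_nil (by simp) ((runs_clear _ _).seq (.push _ _ _))) ?_
      (by simp [hb])
    simp
  · refine Runs.mono (.popCase_cons (a := none) (l := List.replicate c none)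
      (by simp [List.replicate_succ]) (.seq (T := 2 * b + 3) (T' := 2 * c + 4)
      (S' := Stacks.get { s with
        cnt := List.replicate c none
        chg := []
        bad := if 0 < b then none :: s.bad else s.bad }) ?_ ?_)) (by omega)
    · rcases b with _ | b
      · refine Runs.cast (.popCase_nil (by simp [hb]) (.skip _)) ?_ (by omega)
        simp only [List.replicate_zero] at hb
        simp [hb]
      · refine Runs.cast (.popCase_cons (a := none) (l := List.replicate b none)
          (by simp [hb, List.replicate_succ]) ((Runs.push _ _ _).seq (runs_clear _ _))) ?_
          (by simp; omega)
        simp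
    · rcases c with _ | c
      · refine Runs.cast (.popCase_nil (by simp) (.push _ _ _)) ?_ (by omega)
        simp
      · refine Runs.cast (.popCase_cons (a := none) (l := List.replicate c none)
          (by simp [List.replicate_succ]) ((runs_clear _ _).seq (.push _ _ _))) ?_
          (by simp; omega)
        simp

end KernelProg

namespace VertexRecord

theorem length_marks (L : List VertexRecord) : (marks L).length = L.length := by
  induction L with
  | nil => rfl
  | cons r L ih => simp [marks, ih]

theorem badCount_le_length (L : List VertexRecord) : badCount L ≤ L.length := by
  induction L with
  | nil => simp [badCount]
  | cons r L ih =>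
    simp only [badCount, List.length_cons]
    split <;> omega

end VertexRecord

namespace KernelProg

open StackProg VertexRecord

/-- Move the next vertex from `inp` to `prev`, and decide whether it is kept. -/
def addVertex : StackProg Stk (Option Bool) :=
  seq (readWord .inp .row) <| seq (readWord .inp .src) <| seq (readWord .inp .tmp) <|
  seq (push .prev none) <| seq (move .tmp .prev) <|
  seq (push .prev none) <| seq (copyReverse .src .prev .aux) <|
  seq (push .prev none) <| seq (copyReverse .row .prev .aux) <|
  seq (copy .prev .scan .aux) <| seq (whileNonempty .scan scanVertex) <|
  seq classify <| seq (clear .row) (clear .src)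

/-- The three words are pushed on `prev` in reverse order, target first, so that the record reads
forward from the top. The scan runs over a copy of `prev` that already contains the new vertex, so
its own change of color is counted too. -/
theorem runs_addVertex (r : VertexRecord) (L : List VertexRecord) (out l : List (Option Bool))
    (N : ℕ) (hN : r.size + (encodeList L).length ≤ N) :
    Runs addVertex
      (Stacks.get {
    inp := encodeList [r] ++ l, out := out, prev := encodeList L,
        mask := (marks L).map some, bad := List.replicate (badCount L) none })
      (Stacks.get {
    inp := l, out := out, prev := encodeList (r :: L),
        mask := (marks (r :: L)).map some, bad := List.replicate (badCount (r :: L)) none })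
      ((N + 1) * (50 * (N + 1) + 2) + 50 * (N + 1)) := by
  have hlen := length_le_length_encodeList (r :: L)
  rw [length_encodeList_cons] at hlen
  have hN' : (encodeList (r :: L)).length ≤ N := by rwa [length_encodeList_cons]
  have h1 := runs_readWord (k := Stk.inp) (m := .row) (by decide)
    (Stacks.get {
    inp := encodeList [r] ++ l, out := out, prev := encodeList L,
      mask := (marks L).map some, bad := List.replicate (badCount L) none }) r.row
    (r.source.map some ++ none :: (r.target.map some ++ none :: l)) (by simp)
  have h2 := runs_readWord (k := Stk.inp) (m := .src) (by decide)
    (Stacks.get {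
    inp := r.source.map some ++ none :: (r.target.map some ++ none :: l), out := out,
      prev := encodeList L, row := r.row.reverse.map some,
      mask := (marks L).map some, bad := List.replicate (badCount L) none }) r.source
    (r.target.map some ++ none :: l) (by simp)
  have h3 := runs_readWord (k := Stk.inp) (m := .tmp) (by decide)
    (Stacks.get {
    inp := r.target.map some ++ none :: l, out := out,
      prev := encodeList L, row := r.row.reverse.map some, src := r.source.reverse.map some,
      mask := (marks L).map some, bad := List.replicate (badCount L) none }) r.target l (by simp)
  have h4 := runs_move (k := Stk.tmp) (m := .prev) (by decide)
    (Stacks.get {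
    inp := l, out := out,
      prev := none :: encodeList L, row := r.row.reverse.map some, src := r.source.reverse.map some,
      tmp := r.target.reverse.map some,
      mask := (marks L).map some, bad := List.replicate (badCount L) none })
  have h5 := runs_copyReverse (k := Stk.src) (m := .prev) (t := .aux) (by decide) (by decide)
    (by decide) (Stacks.get {
    inp := l, out := out,
      prev := none :: (r.target.map some ++ none :: encodeList L), row := r.row.reverse.map some,
      src := r.source.reverse.map some,
      mask := (marks L).map some, bad := List.replicate (badCount L) none }) rfl
  have h6 := runs_copyReverse (k := Stk.row) (m := .prev) (t := .aux) (by decide) (by decide)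
    (by decide) (Stacks.get {
    inp := l, out := out,
      prev := none :: (r.source.map some ++ none :: (r.target.map some ++ none :: encodeList L)),
      row := r.row.reverse.map some, src := r.source.reverse.map some,
      mask := (marks L).map some, bad := List.replicate (badCount L) none }) rfl
  have h7 := runs_copy (k := Stk.prev) (m := .scan) (t := .aux) (by decide) (by decide)
    (by decide) (Stacks.get {
    inp := l, out := out, prev := encodeList (r :: L),
      row := r.row.reverse.map some, src := r.source.reverse.map some,
      mask := (marks L).map some, bad := List.replicate (badCount L) none }) rfl
  have h8 := runs_scan (r :: L) {
    inp := l, out := out, prev := encodeList (r :: L),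
      scan := encodeList (r :: L), row := r.row.reverse.map some, src := r.source.reverse.map some,
      mask := (marks L).map some, bad := List.replicate (badCount L) none } r N (by omega)
      hN' rfl rfl rfl rfl rfl rfl rfl
  have h9 := runs_classify {
    inp := l, out := out, prev := encodeList (r :: L),
      row := r.row.reverse.map some, src := r.source.reverse.map some,
      cnt := List.replicate (L.countP r.twin + 1) none,
      chg := List.replicate ((r :: L).countP r.changedTwin) none,
      mask := (marks L).map some, bad := List.replicate (badCount L) none }
      (L.countP r.twin) ((r :: L).countP r.changedTwin) rfl rfl
  have h10 := runs_clear Stk.row (Stacks.get {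
    inp := l, out := out, prev := encodeList (r :: L),
      row := r.row.reverse.map some, src := r.source.reverse.map some,
      mask := (marks (r :: L)).map some, bad := List.replicate (badCount (r :: L)) none })
  have h11 := runs_clear Stk.src (Stacks.get {
    inp := l, out := out, prev := encodeList (r :: L),
      src := r.source.reverse.map some,
      mask := (marks (r :: L)).map some, bad := List.replicate (badCount (r :: L)) none })
  have hc : (r :: L).countP r.twin = L.countP r.twin + 1 := by simp [twin_self]
  have hbad : (if 1 ≤ L.countP r.twin ∧ 0 < (r :: L).countP r.changedTwin then
      (none : Option Bool) :: List.replicate (badCount L) none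
      else List.replicate (badCount L) none) = List.replicate (badCount (r :: L)) none := by
    simp only [badCount]
    split
    · rw [add_comm, List.replicate_succ]
    · simp
  simp only [Stacks.update_get, Stacks.set, Stacks.get, List.append_nil, List.map_reverse,
    List.reverse_reverse, List.length_reverse, List.length_map, hc, hbad]
    at h1 h2 h3 h4 h5 h6 h7 h8 h9 h10 h11
  have hm : List.countP r.twin L ≤ L.length := List.countP_le_length
  have hm' : (r :: L).countP r.changedTwin ≤ (r :: L).length := List.countP_le_length
  have hsize := hN
  rw [size] at hsize
  rw [← encodeList_cons] at h6
  refine Runs.mono (h1.seq (h2.seq (h3.seq ((runs_push_get _ _ _).seq (h4.seq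
    ((runs_push_get _ _ _).seq (h5.seq ((runs_push_get _ _ _).seq (h6.seq (h7.seq
    (h8.seq (h9.seq (h10.seq h11))))))))))))) ?_
  -- A record takes at least one symbol, so at most `N` vertices are scanned.
  have h12 : (r :: L).length * (50 * (N + 1) + 2) ≤ (N + 1) * (50 * (N + 1) + 2) :=
    Nat.mul_le_mul_right _ (by omega)
  simp only [List.length_cons] at hm' hlen h12 ⊢
  omega

theorem runs_addVertices (R L : List VertexRecord) (out : List (Option Bool))
    (N : ℕ) (hN : (encodeList R).length + (encodeList L).length ≤ N) :
    Runs (whileNonempty .inp addVertex)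
      (Stacks.get {
    inp := encodeList R, out := out, prev := encodeList L,
        mask := (marks L).map some, bad := List.replicate (badCount L) none })
      (Stacks.get {
    out := out, prev := encodeList (R.reverse ++ L),
        mask := (marks (R.reverse ++ L)).map some,
        bad := List.replicate (badCount (R.reverse ++ L)) none })
      (R.length * ((N + 1) * (50 * (N + 1) + 2) + 50 * (N + 1) + 2) + 1) := by
  induction R generalizing L with
  | nil => exact (Runs.whileNonempty_nil (by simp)).cast (by simp) (by simp)
  | cons r R ih =>
    rw [length_encodeList_cons] at hN
    have h1 := runs_addVertex r L out (encodeList R) N (by omega)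
    have h2 := ih (r :: L) (by rw [length_encodeList_cons]; omega)
    rw [← encodeList_append, List.singleton_append] at h1
    refine (Runs.whileNonempty_cons (by simp) h1 h2).cast (by simp) ?_
    simp only [List.length_cons]
    ring_nf
    omega

/-- Move the marked symbols of `row` to `inp`, the marks being on `tmp`. -/
def selectRow : StackProg Stk (Option Bool) :=
  forEach .row fun a => popCase .tmp fun o => if o = some (some true) then push .inp a else skip

theorem runs_selectRow (s : Stacks) (u m : List Bool) (hu : s.row = u.map some)
    (hm : s.tmp = m.map some) (hum : u.length = m.length) :
    Runs selectRow s.get { s with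
      row := []
      tmp := []
      inp := (selectMarked u m).reverse.map some ++ s.inp }.get (3 * u.length + 1) := by
  induction u generalizing s m with
  | nil =>
    obtain rfl : m = [] := List.length_eq_zero_iff.1 hum.symm
    refine (Runs.forEach_nil (by simpa using hu)).cast ?_ (by simp)
    obtain ⟨inp, out, prev, scan, row, src, tmp, aux, neq, neqTgt, cnt, chg, bad, mask⟩ := s
    simp only [List.map_nil] at hu hm
    simp [hu, hm, selectMarked]
  | cons a u ih =>
    obtain ⟨b, m, rfl⟩ : ∃ b m', m = b :: m' :=
      List.exists_cons_of_length_pos (by rw [← hum]; simp)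
    cases b
    · have h := ih { s with row := u.map some, tmp := m.map some } m rfl rfl (by simpa using hum)
      refine (Runs.forEach_cons (a := some a) (l := u.map some) (T := 2) (by simp [hu])
        (.popCase_cons (a := some false) (l := m.map some) (by simp [hm])
          (by simpa using Runs.skip _)) h).cast ?_ (by simp; omega)
      simp [selectMarked]
    · have h := ih { s with row := u.map some, tmp := m.map some, inp := some a :: s.inp } m rfl rfl
        (by simpa using hum)
      refine (Runs.forEach_cons (a := some a) (l := u.map some) (T := 2) (by simp [hu])
        (.popCase_cons (a := some true) (l := m.map some) (by simp [hm])
          (by simpa using runs_push_get Stk.inp (some a) _)) h).cast ?_ (by simp; omega)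
      simp [selectMarked]

/-- Move the last vertex of `prev`, if it is marked, to `inp`, with its row restricted. -/
def emitVertex : StackProg Stk (Option Bool) :=
  seq (readWord .prev .row) <| seq (readWord .prev .src) <| seq (readWord .prev .tmp) <|
  popCase .scan fun o => if o = some (some true) then
    seq (push .inp none) <| seq (move .tmp .inp) <| seq (push .inp none) <|
    seq (move .src .inp) <| seq (push .inp none) <| seq (copy .mask .tmp .aux) selectRow
  else seq (clear .row) <| seq (clear .src) (clear .tmp)

/-- `readWord` leaves the row with its last column on top, in line with `mask`, whose top belongs to
the latest vertex; pushing the selected symbols on `inp` restores the order of the columns. -/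
theorem runs_emitVertex (r : VertexRecord) (b : Bool) (m : List Bool)
    (inp out l c bad : List (Option Bool)) (N : ℕ) (hN : r.size ≤ N) (hm : r.row.length = m.length) :
    Runs emitVertex
      (Stacks.get {
    inp := inp, out := out, prev := encodeList [r] ++ l, scan := some b :: c,
        mask := m.map some, bad := bad })
      (Stacks.get {
    inp := encodeList (if b then [⟨(selectMarked r.row.reverse m).reverse,
          r.source, r.target⟩] else []) ++ inp, out := out, prev := l, scan := c,
        mask := m.map some, bad := bad }) (12 * N + 20) := by
  rw [size] at hN
  have h1 := runs_readWord (k := Stk.prev) (m := .row) (by decide)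
    (Stacks.get {
    inp := inp, out := out, prev := encodeList [r] ++ l, scan := some b :: c,
        mask := m.map some, bad := bad }) r.row
    (r.source.map some ++ none :: (r.target.map some ++ none :: l)) (by simp)
  have h2 := runs_readWord (k := Stk.prev) (m := .src) (by decide)
    (Stacks.get {
    inp := inp, out := out, row := r.row.reverse.map some,
      prev := r.source.map some ++ none :: (r.target.map some ++ none :: l), scan := some b :: c,
      mask := m.map some, bad := bad }) r.source
    (r.target.map some ++ none :: l) (by simp)
  have h3 := runs_readWord (k := Stk.prev) (m := .tmp) (by decide)
    (Stacks.get {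
    inp := inp, out := out, row := r.row.reverse.map some,
      src := r.source.reverse.map some, prev := r.target.map some ++ none :: l, scan := some b :: c,
      mask := m.map some, bad := bad }) r.target l (by simp)
  simp only [Stacks.update_get, Stacks.set, Stacks.get, List.append_nil] at h1 h2 h3
  refine Runs.mono (h1.seq (h2.seq (h3.seq (.popCase_cons (a := some b) (l := c) (by simp)
    (?_ : Runs _ _ _ (9 * N + 15)))))) (by omega)
  simp only [Stacks.update_get, Stacks.set, List.map_reverse]
  cases b
  · simp only [Option.some.injEq, Bool.false_eq_true, if_false]
    refine ((runs_clear _ _).seq ((runs_clear _ _).seq (runs_clear _ _))).cast ?_ ?_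
    · simp
    · simp; omega
  · simp only [if_true]
    have h4 := runs_move (k := Stk.tmp) (m := .inp) (by decide)
      (Stacks.get {
    inp := none :: inp, out := out, row := r.row.reverse.map some,
        src := r.source.reverse.map some, tmp := r.target.reverse.map some, prev := l, scan := c,
        mask := m.map some, bad := bad })
    have h5 := runs_move (k := Stk.src) (m := .inp) (by decide)
      (Stacks.get {
    inp := none :: (r.target.map some ++ none :: inp), out := out,
        row := r.row.reverse.map some,
        src := r.source.reverse.map some, prev := l, scan := c,
        mask := m.map some, bad := bad })
    have h6 := runs_copy (k := Stk.mask) (m := .tmp) (t := .aux) (by decide) (by decide)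
      (by decide)
      (Stacks.get {
    inp := none :: (r.source.map some ++ none :: (r.target.map some ++ none :: inp)),
        out := out, row := r.row.reverse.map some, prev := l, scan := c,
        mask := m.map some, bad := bad }) rfl
    have h7 := runs_selectRow
      {
    inp := none :: (r.source.map some ++ none :: (r.target.map some ++ none :: inp)),
        out := out, row := r.row.reverse.map some, prev := l, scan := c, tmp := m.map some,
        mask := m.map some, bad := bad } r.row.reverse m rfl rfl (by simpa using hm)
    simp only [Stacks.update_get, Stacks.set, Stacks.get, List.append_nil, List.map_reverse,
      List.reverse_reverse, List.length_reverse, List.length_map] at h4 h5 h6 h7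
    refine ((runs_push_get _ _ _).seq (h4.seq ((runs_push_get _ _ _).seq
      (h5.seq ((runs_push_get _ _ _).seq (h6.seq h7)))))).cast ?_ ?_
    · simp
    · omega

/-- The vertices leave `prev` latest first and are stacked on `inp`, so the output is in the
original order again. The marks serve twice: `c`, which is consumed, selects vertices, and `m`,
which stays, selects columns. -/
theorem runs_emitVertices (L : List VertexRecord) (c m : List Bool)
    (inp out bad : List (Option Bool)) (N : ℕ) (hN : (encodeList L).length ≤ N)
    (hm : ∀ r ∈ L, r.row.length = m.length) (hc : c.length = L.length) :
    Runs (whileNonempty .prev emitVertex)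
      (Stacks.get {
    inp := inp, out := out, prev := encodeList L, scan := c.map some,
        mask := m.map some, bad := bad })
      (Stacks.get {
    inp := encodeList (restrictMarked m L c) ++ inp, out := out,
        mask := m.map some, bad := bad }) (L.length * (12 * N + 22) + 1) := by
  induction L generalizing c inp with
  | nil =>
    obtain rfl : c = [] := List.length_eq_zero_iff.1 hc
    exact (Runs.whileNonempty_nil (by simp)).cast (by simp [restrictMarked]) (by simp)
  | cons r L ih =>
    obtain ⟨b, c, rfl⟩ : ∃ b c', c = b :: c' :=
      List.exists_cons_of_length_pos (by rw [hc]; simp)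
    rw [length_encodeList_cons] at hN
    have h1 := runs_emitVertex r b m inp out (encodeList L) (c.map some) bad N (by omega)
      (hm r (by simp))
    rw [← encodeList_append, List.singleton_append] at h1
    have h2 := ih c (encodeList (if b then [⟨(selectMarked r.row.reverse m).reverse,
      r.source, r.target⟩] else []) ++ inp) (by omega) (fun r hr => hm r (by simp [hr])) (by simpa using hc)
    refine (Runs.whileNonempty_cons (by simp) h1 h2).cast ?_ ?_
    · rw [restrictMarked, encodeList_append, List.append_assoc]
    · simp only [List.length_cons]
      ring_nf
      omega

/-- Compute the kernel of the instance on the stack `inp`, answering `w` for a negative instance. -/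
def kernelProg (w : List (Option Bool)) : StackProg Stk (Option Bool) :=
  seq (readWord .inp .out) <| seq (push .out none) <| seq (whileNonempty .inp addVertex) <|
  popCase .bad fun o => o.elim
    (seq (copy .mask .scan .aux) <| seq (whileNonempty .prev emitVertex) <|
      seq (clear .mask) (move .out .inp))
    (fun _ => seq (clear .bad) <| seq (clear .prev) <| seq (clear .mask) <| seq (clear .out) <|
      pushAll .inp w)

/-- A bound for the running time of the kernelization machine. -/
def timeBound (c N : ℕ) : ℕ :=
  (N + 1) * ((N + 1) * (50 * (N + 1) + 2) + 50 * (N + 1) + 2) +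
    (N + 1) * (12 * (N + 1) + 22) + 100 * (N + 1) + c

/-- Rows as long as the list of records make the marks of the vertices usable as marks of the
columns. -/
theorem runs_kernelProg (w : List (Option Bool)) (k : List Bool) (R : List VertexRecord)
    (hR : ∀ r ∈ R, r.row.length = R.length) :
    Runs (kernelProg w) (Stacks.get { inp := k.map some ++ none :: encodeList R })
      (Stacks.get {
    inp := if badCount R.reverse = 0 then
        k.map some ++ none :: encodeList (restrictMarked (marks R.reverse) R.reverse
          (marks R.reverse)) else w })
      (timeBound w.length (k.map some ++ none :: encodeList R).length) := by
  set N := (k.map some ++ none :: encodeList R).length with hNdef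
  have hN : N = k.length + (encodeList R).length + 1 := by simp [hNdef]; omega
  have hlen := length_le_length_encodeList R
  have hrev : (encodeList R.reverse).length = (encodeList R).length := by
    clear * -
    induction R with
    | nil => rfl
    | cons r R ih => rw [List.reverse_cons, encodeList_append, List.length_append,
        length_encodeList_cons, length_encodeList_cons, ih]; simp; omega
  have h1 := runs_readWord (k := Stk.inp) (m := .out) (by decide)
    (Stacks.get { inp := k.map some ++ none :: encodeList R }) k (encodeList R) rfl
  have h2 := runs_addVertices R [] (none :: k.reverse.map some) N (by simp; omega)
  simp only [Stacks.update_get, Stacks.set, Stacks.get, List.append_nil, marks, badCount,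
    List.replicate_zero, List.map_nil, encodeList_nil] at h1 h2
  have hb : R.length * ((N + 1) * (50 * (N + 1) + 2) + 50 * (N + 1) + 2) ≤
      (N + 1) * ((N + 1) * (50 * (N + 1) + 2) + 50 * (N + 1) + 2) :=
    Nat.mul_le_mul_right _ (by omega)
  have hb2 : R.length * (12 * N + 22) ≤ (N + 1) * (12 * (N + 1) + 22) :=
    Nat.mul_le_mul (by omega) (by omega)
  refine Runs.mono (h1.seq ((Runs.push _ _ _).seq (Runs.seq (by simpa using h2)
    (?_ : Runs _ _ _ (R.length * (12 * N + 22) + 40 * (N + 1) + w.length))))) (by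
      simp only [timeBound]; omega)
  -- An empty stack `bad` means that the first rule finds nothing, so the marked part is printed;
  -- otherwise all stacks are emptied and `w` is written.
  by_cases hbad : badCount R.reverse = 0
  · simp only [hbad, if_true]
    have h3 := runs_copy (k := Stk.mask) (m := .scan) (t := .aux) (by decide) (by decide)
      (by decide) (Stacks.get {
    out := none :: k.reverse.map some, prev := encodeList R.reverse,
        mask := (marks R.reverse).map some }) rfl
    have h4 := runs_emitVertices R.reverse (marks R.reverse) (marks R.reverse) []
      (none :: k.reverse.map some) [] N (by omega) (fun r hr => by
        rw [length_marks, List.length_reverse]; exact hR r (by simpa using hr))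
        (length_marks _)
    have h5 := runs_clear Stk.mask (Stacks.get {
      inp := encodeList (restrictMarked (marks R.reverse) R.reverse (marks R.reverse)) ++ [],
      out := none :: k.reverse.map some, mask := (marks R.reverse).map some })
    have h6 := runs_move (k := Stk.out) (m := .inp) (by decide) (Stacks.get {
      inp := encodeList (restrictMarked (marks R.reverse) R.reverse (marks R.reverse)) ++ [],
      out := none :: k.reverse.map some })
    simp only [Stacks.update_get, Stacks.set, Stacks.get, List.append_nil] at h3 h4 h5 h6
    refine Runs.cast (.popCase_nil (by simp) (Runs.seq (by simpa using h3)
      (h4.seq (h5.seq h6)))) ?_ ?_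
    · simp
    · simp only [List.length_reverse, List.length_map, length_marks, List.length_cons]
      omega
  · simp only [if_neg hbad]
    obtain ⟨b, hb⟩ := Nat.exists_eq_succ_of_ne_zero hbad
    have hb' := badCount_le_length R.reverse
    rw [List.length_reverse] at hb'
    refine Runs.cast (.popCase_cons (a := none) (l := List.replicate b none)
      (by simp [hb, List.replicate_succ]) ((runs_clear _ _).seq ((runs_clear _ _).seq
        ((runs_clear _ _).seq ((runs_clear _ _).seq (runs_pushAll _ _ _)))))) ?_ ?_
    · simp
    · simp [length_marks, hrev]
      omega

end KernelProg

-- Twins under color swapping, and the safeness of both rules.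

universe v

/-- If `a` were an end of the swapped edge, the other end `q` would receive the color of `a`. But
`q` is adjacent to `b` too, and `b` keeps this same color, so the new coloring would not be proper.
-/
theorem ColorSwapAdj.eq_of_twin {V : Type u} {G : SimpleGraph V} {k : ℕ}
    {f f' : G.Coloring (Fin k)} (h : ColorSwapAdj f f') {a b : V} (hab : a ≠ b)
    (hN : G.neighborSet a = G.neighborSet b) (hf : f a = f b) : f' a = f a := by
  obtain ⟨p, q, hpq, h1, h2, h3⟩ := h
  -- Stated for an oriented edge, so that it excludes both ends.
  have key : ∀ p q : V, G.Adj p q → f p = f' q →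
      (∀ w : V, w ≠ p → w ≠ q → f w = f' w) → a ≠ p := by
    rintro p q hpq h1 h3 rfl
    have hbq : G.Adj b q := by
      have : q ∈ G.neighborSet a := hpq
      rwa [hN] at this
    exact f'.valid hbq ((h3 b hab.symm hbq.ne).symm.trans (hf.symm.trans h1))
  exact (h3 a (key p q hpq h1 h3)
    (key q p hpq.symm h2 fun w hq hp => h3 w hp hq)).symm

theorem Reconfigurable.eq_of_twin {V : Type u} {G : SimpleGraph V} {k : ℕ}
    {f f' : G.Coloring (Fin k)} (h : Reconfigurable f f') {a b : V} (hab : a ≠ b)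
    (hN : G.neighborSet a = G.neighborSet b) (hf : f a = f b) : f' a = f a := by
  -- Both colors are followed together, as the next step needs the twins to agree still.
  suffices f' a = f a ∧ f' b = f b from this.1
  induction h with
  | refl => exact ⟨rfl, rfl⟩
  | tail _ h ih =>
    have hab' := ih.1.trans (hf.trans ih.2.symm)
    exact ⟨(h.eq_of_twin hab hN hab').trans ih.1,
      (h.eq_of_twin hab.symm hN.symm hab'.symm).trans ih.2⟩

namespace CRCSInstance

variable {V : Type u} {V' : Type v}

theorem not_isYes_of_twin (x : CRCSInstance V) {a b : V} (hab : a ≠ b)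
    (hN : x.graph.neighborSet a = x.graph.neighborSet b) (hs : x.source a = x.source b)
    (ht : x.source a ≠ x.target a ∨ x.source b ≠ x.target b) : ¬ x.IsYes := by
  intro h
  rcases ht with ht | ht
  · exact ht (h.eq_of_twin hab hN hs).symm
  · exact ht (h.eq_of_twin hab.symm hN.symm hs.symm).symm

/-- The instance induced on the vertices in the range of `e`. -/
def restrict (x : CRCSInstance V) (e : V' ↪ V) : CRCSInstance V' where
  graph := x.graph.comap e
  numColors := x.numColors
  numColors_pos := x.numColors_pos
  source := x.source.comp (SimpleGraph.Embedding.comap e x.graph).toHom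
  target := x.target.comp (SimpleGraph.Embedding.comap e x.graph).toHom

theorem isSplitPartition_restrict (x : CRCSInstance V) (e : V' ↪ V) {C I : Set V}
    (h : IsSplitPartition x.graph C I) :
    IsSplitPartition (x.restrict e).graph (e ⁻¹' C) (e ⁻¹' I) where
  clique _ ha _ hb hab := h.clique ha hb (e.injective.ne hab)
  indep _ ha _ hb hab := h.indep ha hb (e.injective.ne hab)
  disjoint := h.disjoint.preimage e
  union_eq := by rw [← Set.preimage_union, h.union_eq, Set.preimage_univ]

/-- The removed vertices have equal initial and final colors, so they contribute equally to both
counts of each color. -/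
theorem isValid_restrict [Finite V] (x : CRCSInstance V) (e : V' ↪ V)
    (hfix : ∀ w ∉ Set.range e, x.source w = x.target w) (hx : x.IsValid) :
    (x.restrict e).IsValid := by
  have key : ∀ (f : V → Fin x.numColors) (c : Fin x.numColors), {v | f v = c}.ncard =
      {a | f (e a) = c}.ncard + {w | w ∉ Set.range e ∧ f w = c}.ncard := by
    intro f c
    rw [← Set.ncard_image_of_injective _ e.injective, ← Set.ncard_union_eq]
    · congr 1
      ext v
      simp only [Set.mem_ofPred_eq, Set.mem_union, Set.mem_image, Set.mem_range]
      constructor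
      · intro h
        by_cases hv : ∃ a, e a = v
        · obtain ⟨a, rfl⟩ := hv
          exact Or.inl ⟨a, h, rfl⟩
        · exact Or.inr ⟨hv, h⟩
      · rintro (⟨a, h, rfl⟩ | ⟨_, h⟩) <;> exact h
    · rw [Set.disjoint_left]
      rintro _ ⟨a, _, rfl⟩ ⟨h, _⟩
      exact h ⟨a, rfl⟩
  intro c
  have h := hx c
  have hs := key x.source c
  have ht := key x.target c
  have h2 : {w | w ∉ Set.range e ∧ x.source w = c} = {w | w ∉ Set.range e ∧ x.target w = c} := by
    ext w
    simp only [Set.mem_ofPred_eq]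
    exact and_congr_right fun hw => by rw [hfix w hw]
  rw [h2] at hs
  exact Nat.add_right_cancel (hs.symm.trans (h.trans ht))

/-- Each vertex outside of the range of `e` has two twins of the same initial color in the range
of `e`. -/
def TwinsKept (x : CRCSInstance V) (e : V' ↪ V) : Prop :=
  ∀ w ∉ Set.range e, ∃ a b : V', a ≠ b ∧
    x.graph.neighborSet (e a) = x.graph.neighborSet w ∧
    x.graph.neighborSet (e b) = x.graph.neighborSet w ∧
    x.source (e a) = x.source w ∧ x.source (e b) = x.source w

/-- Removed vertices are frozen by their kept twins, so every swap takes place between two kept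
vertices. -/
theorem reconfigurable_restrict (x : CRCSInstance V) (e : V' ↪ V) (hk : x.TwinsKept e)
    {g : x.graph.Coloring (Fin x.numColors)} (h : Reconfigurable x.source g) :
    Reconfigurable (x.restrict e).source
      (g.comp (SimpleGraph.Embedding.comap e x.graph).toHom) := by
  induction h with
  | refl => exact .refl
  | @tail g h hg hgh ih =>
    refine ih.tail ?_
    obtain ⟨p, q, hpq, h1, h2, h3⟩ := id hgh
    have fixed : ∀ w ∉ Set.range e, h w = g w := by
      intro w hw
      obtain ⟨a, _, _, ha, _, ha', _⟩ := hk w hw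
      have hne : w ≠ e a := fun h => hw ⟨a, h.symm⟩
      exact (Reconfigurable.eq_of_twin (hg.tail hgh) hne ha.symm ha'.symm).trans
        (Reconfigurable.eq_of_twin hg hne ha.symm ha'.symm).symm
    -- A swap at a removed `p` would give it the color of its neighbor `q`; as `p` keeps its color,
    -- `p` and `q` would already have had equal colors.
    have mem : ∀ p q, x.graph.Adj p q → g q = h p → p ∈ Set.range e := by
      intro p q hpq h2
      by_contra hp
      exact g.valid hpq ((fixed p hp).symm.trans h2.symm)
    obtain ⟨p, rfl⟩ := mem p q hpq h2
    obtain ⟨q, rfl⟩ := mem q _ hpq.symm h1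
    exact ⟨p, q, hpq, h1, h2, fun w hp hq => h3 (e w) (e.injective.ne hp) (e.injective.ne hq)⟩

/-- Removed vertices keep their initial color throughout. This stays proper because the two kept
twins of such a vertex freeze each other, so that at any time a kept vertex has its neighbors and
its color. -/
theorem exists_reconfigurable_of_restrict (x : CRCSInstance V) (e : V' ↪ V) (hk : x.TwinsKept e)
    {g' : (x.restrict e).graph.Coloring (Fin x.numColors)}
    (h : Reconfigurable (x.restrict e).source g') :
    ∃ g : x.graph.Coloring (Fin x.numColors), Reconfigurable x.source g ∧
      (∀ a, g (e a) = g' a) ∧ ∀ w ∉ Set.range e, g w = x.source w := by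
  classical
  induction h with
  | refl => exact ⟨x.source, .refl, fun _ => rfl, fun _ _ => rfl⟩
  | @tail g' h' hg hgh ih =>
    obtain ⟨g, hr, hge, hgw⟩ := ih
    let h : V → Fin x.numColors := fun v => if hv : ∃ a, e a = v then h' hv.choose else x.source v
    have he : ∀ a, h (e a) = h' a := by
      intro a
      have hv : ∃ b, e b = e a := ⟨a, rfl⟩
      simp only [h, dif_pos hv]
      rw [e.injective hv.choose_spec]
    have hw : ∀ w ∉ Set.range e, h w = x.source w := fun w hw => dif_neg hw
    -- Replacing a removed end of an edge by this kept twin reduces properness to the kept vertices.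
    -- The second twin `b` is what freezes `a`.
    have twin : ∀ w ∉ Set.range e, ∃ b, h (e b) = h w ∧
        x.graph.neighborSet (e b) = x.graph.neighborSet w := by
      intro w hwr
      obtain ⟨a, b, hab, ha, hb, ha', hb'⟩ := hk w hwr
      refine ⟨a, ?_, ha⟩
      rw [he, hw w hwr, ← ha']
      refine Reconfigurable.eq_of_twin (hg.tail hgh) hab ?_ (ha'.trans hb'.symm)
      have : x.graph.neighborSet (e a) = x.graph.neighborSet (e b) := ha.trans hb.symm
      ext c
      exact Set.ext_iff.1 this (e c)
    have proper1 : ∀ (a : V') (w : V), x.graph.Adj (e a) w → h (e a) ≠ h w := by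
      intro a w haw
      by_cases hwr : w ∈ Set.range e
      · obtain ⟨b, rfl⟩ := hwr
        rw [he, he]
        exact h'.valid (show (x.restrict e).graph.Adj a b from haw)
      · obtain ⟨b, hb, hb'⟩ := twin w hwr
        have hba : x.graph.Adj (e b) (e a) := by
          have : e a ∈ x.graph.neighborSet w := haw.symm
          rwa [← hb'] at this
        rw [← hb, he, he]
        exact h'.valid (show (x.restrict e).graph.Adj a b from hba.symm)
    have proper : ∀ {p q : V}, x.graph.Adj p q → h p ≠ h q := by
      intro p q hpq
      by_cases hp : p ∈ Set.range e
      · obtain ⟨a, rfl⟩ := hp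
        exact proper1 a q hpq
      · obtain ⟨b, hb, hb'⟩ := twin p hp
        rw [← hb]
        have : q ∈ x.graph.neighborSet p := hpq
        rw [← hb'] at this
        exact proper1 b q this
    refine ⟨SimpleGraph.Coloring.mk h proper, hr.tail ?_, he, hw⟩
    obtain ⟨p, q, hpq, h1, h2, h3⟩ := hgh
    refine ⟨e p, e q, hpq, ?_, ?_, fun w hp hq => ?_⟩
    · exact (hge p).trans (h1.trans (he q).symm)
    · exact (hge q).trans (h2.trans (he p).symm)
    · by_cases hwr : w ∈ Set.range e
      · obtain ⟨a, rfl⟩ := hwr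
        exact (hge a).trans ((h3 a (fun h => hp (h ▸ rfl)) (fun h => hq (h ▸ rfl))).trans
          (he a).symm)
      · exact (hgw w hwr).trans (hw w hwr).symm

theorem isYes_restrict_iff (x : CRCSInstance V) (e : V' ↪ V) (hk : x.TwinsKept e)
    (hfix : ∀ w ∉ Set.range e, x.source w = x.target w) : (x.restrict e).IsYes ↔ x.IsYes := by
  refine ⟨fun h => ?_, fun h => x.reconfigurable_restrict e hk h⟩
  obtain ⟨g, hr, hge, hgw⟩ := x.exists_reconfigurable_of_restrict e hk h
  have : g = x.target := by
    ext v
    congr 1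
    by_cases hv : v ∈ Set.range e
    · obtain ⟨a, rfl⟩ := hv
      exact hge a
    · exact (hgw v hv).trans (hfix v hv)
  rw [this] at hr
  exact hr

theorem deleteVertex_eq_restrict (x : CRCSInstance V) (w : V) :
    x.deleteVertex w = x.restrict (Function.Embedding.subtype (· ∈ ({w}ᶜ : Set V))) := rfl

theorem notMem_range_subtype_compl {w v : V}
    (h : v ∉ Set.range (Function.Embedding.subtype (· ∈ ({w}ᶜ : Set V)))) : v = w := by
  by_contra hv
  exact h ⟨⟨v, hv⟩, rfl⟩

/-- On a split graph, a set of vertices without three twins of the same initial color is small. -/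
theorem card_le_of_twins_le_two [Fintype V] [DecidableEq V] (x : CRCSInstance V) {C I : Set V}
    (h : IsSplitPartition x.graph C I) (s : Finset V)
    (hs : ∀ v ∈ s, ∀ t ⊆ s, (∀ w ∈ t, x.graph.neighborSet w = x.graph.neighborSet v ∧
      x.source w = x.source v) → t.card ≤ 2) :
    s.card ≤ x.numColors + 2 * x.numColors * 2 ^ x.numColors := by
  classical
  rw [← Finset.card_filter_add_card_filter_not (s := s) (· ∈ C)]
  refine add_le_add ?_ ?_
  · have : (s.filter (· ∈ C)).card ≤ (Finset.univ : Finset (Fin x.numColors)).card := by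
      refine Finset.card_le_card_of_injOn x.source (fun _ _ => Finset.mem_coe.2 (Finset.mem_univ _))
        fun a ha b hb hab => ?_
      by_contra hne
      simp only [Finset.coe_filter, Set.mem_ofPred_eq] at ha hb
      exact x.source.valid (h.clique ha.2 hb.2 hne) hab
    simpa using this
  · have hsub : ∀ v ∉ C, ∀ w, x.graph.Adj v w → w ∈ C := by
      intro v hv w hvw
      by_contra hw
      have mem : ∀ u ∉ C, u ∈ I := fun u hu =>
        ((Set.ext_iff.1 h.union_eq u).2 trivial).resolve_left hu
      exact h.indep (mem v hv) (mem w hw) hvw.ne hvw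
    -- Outside of `C` all neighbors lie in the clique, where a vertex is determined by its color. So
    -- the set of neighbor colors determines the neighborhood, and the fibers of `φ` consist of
    -- twins.
    let φ : V → Fin x.numColors × Finset (Fin x.numColors) := fun v =>
      (x.source v, Finset.univ.filter fun c => ∃ w, x.graph.Adj v w ∧ x.source w = c)
    have hφ : ∀ v ∉ C, ∀ w ∉ C, φ v = φ w →
        x.graph.neighborSet v = x.graph.neighborSet w ∧ x.source v = x.source w := by
      intro v hv w hw hvw
      simp only [φ, Prod.mk.injEq] at hvw
      have half : ∀ v ∉ C, ∀ w ∉ C, (Finset.univ.filter fun c => ∃ z, x.graph.Adj v z ∧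
          x.source z = c) = (Finset.univ.filter fun c => ∃ z, x.graph.Adj w z ∧ x.source z = c) →
          x.graph.neighborSet v ⊆ x.graph.neighborSet w := by
        intro v hv w hw heq z hz
        have hz' : x.source z ∈ (Finset.univ.filter fun c => ∃ z, x.graph.Adj v z ∧
          x.source z = c) := by simpa using ⟨z, hz, rfl⟩
        rw [heq] at hz'
        simp only [Finset.mem_filter, Finset.mem_univ, true_and] at hz'
        obtain ⟨z', hz1, hz2⟩ := hz'
        have : z' = z := by
          by_contra hne
          exact x.source.valid (h.clique (hsub w hw z' hz1) (hsub v hv z hz) hne) hz2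
        exact this ▸ hz1
      exact ⟨(half v hv w hw hvw.2).antisymm (half w hw v hv hvw.2.symm), hvw.1⟩
    have := Finset.card_le_mul_card_image (f := φ) (s.filter (· ∉ C)) 2 (by
      intro y hy
      obtain ⟨v, hv, rfl⟩ := Finset.mem_image.1 hy
      rw [Finset.mem_filter] at hv
      refine hs v hv.1 _ (fun w hw => ?_) fun w hw => ?_
      · simp only [Finset.mem_filter] at hw
        exact hw.1.1
      · simp only [Finset.mem_filter] at hw
        exact hφ w hw.1.2 v hv.2 hw.2)
    refine this.trans ?_
    have h2 : ((s.filter (· ∉ C)).image φ).card ≤ x.numColors * 2 ^ x.numColors := by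
      refine (Finset.card_le_univ _).trans ?_
      simp
    rw [mul_assoc]
    exact Nat.mul_le_mul_left 2 h2

end CRCSInstance

/-! ### What the marks and the counter of bad vertices mean. -/

namespace VertexRecord

theorem twin_iff {r w : VertexRecord} :
    r.twin w = true ↔ w.row = r.row ∧ w.source = r.source := by
  simp [twin]

theorem twin_congr {r s : VertexRecord} (h : r.twin s = true) : s.twin = r.twin := by
  funext w
  rw [twin_iff] at h
  simp [twin, h.1, h.2]

/-- A pair of twins is detected at the later one, whose test covers its own color change and those
of all its earlier twins. -/
theorem badCount_eq_zero_iff (L : List VertexRecord) :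
    badCount L = 0 ↔ L.Pairwise fun r w => r.twin w = true →
      r.target = r.source ∧ w.target = w.source := by
  induction L with
  | nil => simp [badCount]
  | cons r L ih =>
    rw [badCount, Nat.add_eq_zero_iff, ih, List.pairwise_cons]
    refine and_congr_left fun _ => ?_
    simp only [ite_eq_right_iff, one_ne_zero, imp_false, not_and, Nat.one_le_iff_ne_zero,
      ← Nat.pos_iff_ne_zero, List.countP_pos_iff, changedTwin, Bool.and_eq_true,
      decide_eq_true_eq, not_exists, List.mem_cons]
    constructor
    · intro h w hw hrw
      have h1 := h ⟨w, hw, hrw⟩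
      refine ⟨?_, ?_⟩
      · by_contra hne
        exact h1 r (Or.inl rfl) (twin_self r) hne
      · by_contra hne
        exact h1 w (Or.inr hw) hrw fun h => hne (h.trans (twin_iff.1 hrw).2.symm)
    · rintro h ⟨w, hw, hrw⟩ s hs hrs hne
      rcases hs with rfl | hs
      · exact hne (h w hw hrw).1
      · exact hne ((h s hs hrs).2.trans (twin_iff.1 hrs).2)

variable {V : Type*} (r : V → VertexRecord)

/-- The vertices of `q` having fewer than two twins later in the list, in reverse order. -/
def keptList : List V → List V
  | [] => []
  | v :: q => if q.countP (fun w => (r v).twin (r w)) < 2 then keptList q ++ [v] else keptList q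

theorem keptList_sublist (q : List V) : (keptList r q).Sublist q.reverse := by
  induction q with
  | nil => exact .refl _
  | cons v q ih =>
    rw [keptList, List.reverse_cons]
    split
    · exact ih.append_right _
    · exact ih.trans (List.sublist_append_left _ _)

theorem restrictMarked_map (m : List Bool) (q : List V) :
    restrictMarked m (q.map r) (marks (q.map r)) = (keptList r q).map fun v =>
      ⟨(selectMarked (r v).row.reverse m).reverse, (r v).source, (r v).target⟩ := by
  induction q with
  | nil => rfl
  | cons v q ih =>
    simp only [List.map_cons, marks, restrictMarked, ih, keptList, List.countP_map,
      decide_eq_true_eq]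
    have : (r v).twin ∘ r = fun w => (r v).twin (r w) := rfl
    rw [this]
    split <;> simp

/-- With `g` an adjacency function, this says that restricting a row to the marked columns is
listing its values at the kept vertices. -/
theorem selectMarked_map {α : Type*} (g : V → α) (q : List V) :
    (selectMarked (q.map g) (marks (q.map r))).reverse = (keptList r q).map g := by
  induction q with
  | nil => rfl
  | cons v q ih =>
    simp only [List.map_cons, marks, selectMarked, keptList, List.countP_map,
      decide_eq_true_eq]
    have : (r v).twin ∘ r = fun w => (r v).twin (r w) := rfl
    rw [this]
    split <;> simp [ih]

/-- A vertex is dropped exactly when its class already has two earlier members, so the kept members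
of a class are its first two. -/
theorem countP_keptList (s : VertexRecord) (q : List V) :
    (keptList r q).countP (fun w => s.twin (r w)) =
      min 2 (q.countP fun w => s.twin (r w)) := by
  induction q with
  | nil => rfl
  | cons v q ih =>
    by_cases hv : s.twin (r v) = true
    · rw [keptList, twin_congr hv]
      by_cases hc : q.countP (fun w => s.twin (r w)) < 2
      · rw [if_pos hc, List.countP_append, ih]
        simp only [List.countP_cons, List.countP_nil, hv, if_true]
        omega
      · rw [if_neg hc, ih]
        simp only [List.countP_cons, hv, if_true]
        omega
    · rw [keptList]
      split
      · rw [List.countP_append, ih]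
        simp [hv]
      · rw [ih]
        simp [hv]

/-- A dropped vertex has at least two earlier twins, and by `countP_keptList` exactly two of them
are kept. -/
theorem exists_twins_mem_keptList (q : List V) (hq : q.Nodup) {v : V} (hv : v ∈ q)
    (hvk : v ∉ keptList r q) : ∃ a ∈ keptList r q, ∃ b ∈ keptList r q, a ≠ b ∧
      (r v).twin (r a) = true ∧ (r v).twin (r b) = true := by
  induction q with
  | nil => simp at hv
  | cons u q ih =>
    have hsub : keptList r q ⊆ keptList r (u :: q) := by
      rw [keptList]
      split
      · exact List.subset_append_left _ _
      · exact List.Subset.refl _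
    rcases List.mem_cons.1 hv with rfl | hv
    · have hc : ¬ q.countP (fun w => (r v).twin (r w)) < 2 := by
        intro h
        rw [keptList, if_pos h] at hvk
        simp at hvk
      have h2 := countP_keptList r (r v) q
      have hnd : (keptList r q).Nodup :=
        (keptList_sublist r q).nodup (List.nodup_reverse.2 (List.nodup_cons.1 hq).2)
      rw [List.countP_eq_length_filter, min_eq_left (by omega)] at h2
      obtain ⟨a, b, hab⟩ := List.length_eq_two.1 h2
      have hnd' := hnd.filter (fun w => (r v).twin (r w))
      rw [hab] at hnd'
      have ha : a ∈ (keptList r q).filter fun w => (r v).twin (r w) := by simp [hab]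
      have hb : b ∈ (keptList r q).filter fun w => (r v).twin (r w) := by simp [hab]
      rw [List.mem_filter] at ha hb
      exact ⟨a, hsub ha.1, b, hsub hb.1, by simpa using hnd', ha.2, hb.2⟩
    · obtain ⟨a, ha, b, hb, h⟩ := ih (List.nodup_cons.1 hq).2 hv fun h => hvk (hsub h)
      exact ⟨a, hsub ha, b, hsub hb, h⟩

theorem length_encodeList_le (L : List VertexRecord) (N : ℕ) (h : ∀ r ∈ L, r.size ≤ N) :
    (encodeList L).length ≤ L.length * N := by
  induction L with
  | nil => simp
  | cons r L ih =>
    rw [length_encodeList_cons, List.length_cons, add_mul, one_mul, add_comm]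
    exact add_le_add (ih fun s hs => h s (by simp [hs])) (h r (by simp))

end VertexRecord

/-- This crude bound suffices, as the kernel size only has to be bounded by some computable function
of the number of colors. -/
theorem length_encodeNat_le (n : ℕ) : (encodeNat n).length ≤ n := by
  have pos : ∀ m : PosNum, (encodePosNum m).length ≤ (m : ℕ) := by
    intro m
    induction m with
    | one => simp [encodePosNum]
    | bit0 m ih =>
      have := PosNum.cast_pos (α := ℕ) m
      simp only [encodePosNum, List.length_cons, PosNum.cast_bit0]
      omega
    | bit1 m ih =>
      have := PosNum.cast_pos (α := ℕ) m
      simp only [encodePosNum, List.length_cons, PosNum.cast_bit1]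
      omega
  have num : ∀ m : Num, (encodeNum m).length ≤ (m : ℕ) := by
    intro m
    cases m with
    | zero => simp [encodeNum]
    | pos m => exact pos m
  simpa [encodeNat] using num n

/-! ### The kernel of an instance: equivalence, size and computation. -/

namespace SplitCRCSInstance

open VertexRecord

open Classical in
/-- The data of a vertex in the encoding of an instance. -/
noncomputable def record (x : SplitCRCSInstance) (v : Fin x.numVertices) : VertexRecord where
  row := List.ofFn fun w => decide (x.toInstance.graph.Adj v w)
  source := encodeNat (x.toInstance.source v)
  target := encodeNat (x.toInstance.target v)

theorem encode_eq (x : SplitCRCSInstance) :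
    x.encode = (encodeNat x.toInstance.numColors).map some ++
      none :: encodeList ((List.finRange x.numVertices).map x.record) := by
  have h : (List.ofFn x.vertexWords).flatten =
      ((List.finRange x.numVertices).map x.record).flatMap words := by
    rw [List.ofFn_eq_map, List.flatMap_map, List.flatMap_def]
    rfl
  rw [encode, h]
  simp [joinWords, encodeList]

theorem twin_record_iff (x : SplitCRCSInstance) (v w : Fin x.numVertices) :
    (x.record v).twin (x.record w) = true ↔
      x.toInstance.graph.neighborSet w = x.toInstance.graph.neighborSet v ∧
        x.toInstance.source w = x.toInstance.source v := by
  rw [twin_iff]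
  refine and_congr ?_ ?_
  · simp only [record, List.ofFn_inj, funext_iff, decide_eq_decide]
    exact Set.ext_iff.symm
  · exact ⟨fun h => Fin.ext (encodeNat_inj h), fun h => by simp only [record, h]⟩

theorem record_target_eq_iff (x : SplitCRCSInstance) (v : Fin x.numVertices) :
    (x.record v).target = (x.record v).source ↔
      x.toInstance.target v = x.toInstance.source v :=
  ⟨fun h => Fin.ext (encodeNat_inj h), fun h => by simp only [record, h]⟩

theorem size_record_le (x : SplitCRCSInstance) (v : Fin x.numVertices) :
    (x.record v).size ≤ x.numVertices + 2 * x.toInstance.numColors + 3 := by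
  have h1 := length_encodeNat_le (x.toInstance.source v)
  have h2 := length_encodeNat_le (x.toInstance.target v)
  have h3 := (x.toInstance.source v).2
  have h4 := (x.toInstance.target v).2
  simp only [VertexRecord.size, record, List.length_ofFn]
  omega

theorem length_encode_le (x : SplitCRCSInstance) : x.encode.length ≤ x.toInstance.numColors + 1 +
    x.numVertices * (x.numVertices + 2 * x.toInstance.numColors + 3) := by
  have h1 := length_encodeNat_le x.toInstance.numColors
  have h2 := length_encodeList_le ((List.finRange x.numVertices).map x.record) _ (by
    intro r hr
    obtain ⟨v, _, rfl⟩ := List.mem_map.1 hr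
    exact x.size_record_le v)
  rw [encode_eq]
  simp only [List.length_append, List.length_map, List.length_cons, List.length_finRange] at h2 ⊢
  omega

/-- Two isolated vertices exchanging their colors. -/
def negative : SplitCRCSInstance where
  numVertices := 2
  toInstance :=
    { graph := ⊥
      numColors := 2
      numColors_pos := by decide
      source := SimpleGraph.Coloring.mk id fun h => h.elim
      target := SimpleGraph.Coloring.mk Fin.rev fun h => h.elim }
  isSplit := ⟨∅, Set.univ, by simp, fun _ _ _ _ _ h => h, by simp, by simp⟩

/-- Without edges there are no swaps, and the two colorings differ. -/
theorem not_isYes_negative : ¬ negative.toInstance.IsYes := by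
  intro h
  rcases Relation.ReflTransGen.cases_head h with h | ⟨_, ⟨_, _, h, _⟩, _⟩
  · have : (0 : Fin 2) = Fin.rev 0 :=
      congrArg (fun f : negative.toInstance.graph.Coloring (Fin 2) => f (0 : Fin 2)) h
    exact absurd this (by decide)
  · exact h.elim

theorem isValid_negative : negative.toInstance.IsValid := by
  intro c
  change Fin 2 at c
  have h1 : {v : Fin 2 | id v = c} = {c} := rfl
  have h2 : {v : Fin 2 | Fin.rev v = c} = {Fin.rev c} := Set.ext fun v => Fin.rev_eq_iff
  exact (congrArg Set.ncard h1).trans ((Set.ncard_singleton _).trans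
    ((Set.ncard_singleton _).symm.trans (congrArg Set.ncard h2).symm))

/-- No vertex having a twin of the same initial color changes its color. -/
def TwinsFixed (x : SplitCRCSInstance) : Prop :=
  ∀ a b : Fin x.numVertices, a ≠ b →
    x.toInstance.graph.neighborSet a = x.toInstance.graph.neighborSet b →
    x.toInstance.source a = x.toInstance.source b →
    x.toInstance.source a = x.toInstance.target a

theorem badCount_records_eq_zero_iff (x : SplitCRCSInstance) :
    badCount ((List.finRange x.numVertices).map x.record).reverse = 0 ↔ x.TwinsFixed := by
  have hnd : (List.finRange x.numVertices).reverse.Nodup :=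
    List.nodup_reverse.2 (List.nodup_finRange _)
  rw [badCount_eq_zero_iff, ← List.map_reverse, List.pairwise_map]
  simp only [twin_record_iff, record_target_eq_iff]
  constructor
  · intro h a b hab hN hs
    have hsymm : Std.Symm fun a b : Fin x.numVertices =>
        x.toInstance.graph.neighborSet b = x.toInstance.graph.neighborSet a ∧
        x.toInstance.source b = x.toInstance.source a →
        x.toInstance.target a = x.toInstance.source a ∧
        x.toInstance.target b = x.toInstance.source b :=
      ⟨fun a b h h' => (h ⟨h'.1.symm, h'.2.symm⟩).symm⟩
    exact (h.forall (by simp) (by simp) hab ⟨hN.symm, hs.symm⟩).1.symm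
  · intro h
    refine hnd.pairwise_of_forall_ne fun a _ b _ hab ⟨hN, hs⟩ => ?_
    exact ⟨(h a b hab hN.symm hs.symm).symm, (h b a hab.symm hN hs).symm⟩

/-- The first two vertices of each class of twins of the same initial color. -/
noncomputable def kept (x : SplitCRCSInstance) : List (Fin x.numVertices) :=
  keptList x.record (List.finRange x.numVertices).reverse

theorem nodup_kept (x : SplitCRCSInstance) : x.kept.Nodup := by
  have := keptList_sublist x.record (List.finRange x.numVertices).reverse
  rw [List.reverse_reverse] at this
  exact this.nodup (List.nodup_finRange _)

/-- The inclusion of the vertices kept. -/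
noncomputable def keptEmbedding (x : SplitCRCSInstance) :
    Fin x.kept.length ↪ Fin x.numVertices :=
  ⟨x.kept.get, List.nodup_iff_injective_get.1 x.nodup_kept⟩

theorem mem_range_keptEmbedding (x : SplitCRCSInstance) {v : Fin x.numVertices} :
    v ∈ Set.range x.keptEmbedding ↔ v ∈ x.kept :=
  List.mem_iff_get.symm

theorem twinsKept (x : SplitCRCSInstance) : x.toInstance.TwinsKept x.keptEmbedding := by
  intro w hw
  rw [mem_range_keptEmbedding] at hw
  obtain ⟨a, ha, b, hb, hab, ha', hb'⟩ := exists_twins_mem_keptList x.record _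
    (List.nodup_reverse.2 (List.nodup_finRange _)) (by simp) hw
  obtain ⟨a, rfl⟩ := x.mem_range_keptEmbedding.2 ha
  obtain ⟨b, rfl⟩ := x.mem_range_keptEmbedding.2 hb
  rw [twin_record_iff] at ha' hb'
  exact ⟨a, b, fun h => hab (h ▸ rfl), ha'.1, hb'.1, ha'.2, hb'.2⟩

theorem TwinsFixed.source_eq_target {x : SplitCRCSInstance} (hx : x.TwinsFixed)
    {w : Fin x.numVertices} (hw : w ∉ Set.range x.keptEmbedding) :
    x.toInstance.source w = x.toInstance.target w := by
  obtain ⟨a, _, _, ha, _, ha', _⟩ := x.twinsKept w hw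
  exact hx w _ (fun h => hw ⟨a, h.symm⟩) ha.symm ha'.symm

/-- Three kept twins are impossible since `countP_keptList` leaves at most two per class. -/
theorem length_kept_le (x : SplitCRCSInstance) : x.kept.length ≤
    x.toInstance.numColors + 2 * x.toInstance.numColors * 2 ^ x.toInstance.numColors := by
  obtain ⟨C, I, h⟩ := x.isSplit
  rw [← List.toFinset_card_of_nodup x.nodup_kept]
  refine x.toInstance.card_le_of_twins_le_two h _ fun v _ t ht htv => ?_
  have hc : x.kept.countP (fun w => (x.record v).twin (x.record w)) = _ :=
    countP_keptList x.record (x.record v) (List.finRange x.numVertices).reverse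
  rw [List.countP_eq_length_filter, ← List.toFinset_card_of_nodup (x.nodup_kept.filter _)] at hc
  refine (Finset.card_le_card fun w hw => ?_).trans (hc.le.trans (min_le_left _ _))
  rw [List.mem_toFinset, List.mem_filter]
  exact ⟨List.mem_toFinset.1 (ht hw), (x.twin_record_iff v w).2 (htv w hw)⟩

/-- The instance induced on the vertices kept. -/
noncomputable def reduced (x : SplitCRCSInstance) : SplitCRCSInstance where
  numVertices := x.kept.length
  toInstance := x.toInstance.restrict x.keptEmbedding
  isSplit := by
    obtain ⟨C, I, h⟩ := x.isSplit
    exact ⟨_, _, x.toInstance.isSplitPartition_restrict x.keptEmbedding h⟩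

open Classical in
/-- The kernelization of CRCS on split graphs. -/
noncomputable def kernel (x : SplitCRCSInstance) : SplitCRCSInstance :=
  if x.TwinsFixed then x.reduced else negative

theorem isYes_kernel_iff (x : SplitCRCSInstance) :
    x.kernel.toInstance.IsYes ↔ x.toInstance.IsYes := by
  by_cases hx : x.TwinsFixed
  · rw [kernel, if_pos hx]
    exact x.toInstance.isYes_restrict_iff x.keptEmbedding x.twinsKept
      fun w hw => hx.source_eq_target hw
  · rw [kernel, if_neg hx]
    refine iff_of_false not_isYes_negative ?_
    simp only [TwinsFixed, not_forall] at hx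
    obtain ⟨a, b, hab, hN, hs, ht⟩ := hx
    exact x.toInstance.not_isYes_of_twin hab hN hs (Or.inl ht)

theorem isValid_kernel (x : SplitCRCSInstance) (h : x.toInstance.IsValid) :
    x.kernel.toInstance.IsValid := by
  by_cases hx : x.TwinsFixed
  · rw [kernel, if_pos hx]
    exact x.toInstance.isValid_restrict x.keptEmbedding (fun w hw => hx.source_eq_target hw) h
  · rw [kernel, if_neg hx]
    exact isValid_negative

theorem numVertices_kernel_le (x : SplitCRCSInstance) : x.kernel.numVertices ≤
    x.toInstance.numColors + 2 * x.toInstance.numColors * 2 ^ x.toInstance.numColors := by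
  by_cases hx : x.TwinsFixed
  · rw [kernel, if_pos hx]
    exact x.length_kept_le
  · rw [kernel, if_neg hx]
    -- The negative instance has two vertices, which the bound admits because there is at least one
    -- color.
    have h1 := x.toInstance.numColors_pos
    have h2 : 1 ≤ 2 ^ x.toInstance.numColors := Nat.one_le_two_pow
    have h3 : 2 * 1 * 1 ≤ 2 * x.toInstance.numColors * 2 ^ x.toInstance.numColors :=
      Nat.mul_le_mul (Nat.mul_le_mul_left _ h1) h2
    show 2 ≤ _
    omega

theorem numColors_kernel_le (x : SplitCRCSInstance) :
    x.kernel.toInstance.numColors ≤ x.toInstance.numColors + 2 := by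
  by_cases hx : x.TwinsFixed
  · rw [kernel, if_pos hx]
    exact Nat.le_add_right _ _
  · rw [kernel, if_neg hx]
    exact Nat.le_add_left _ _

/-- The right side is what the machine prints. Rows and columns are selected by the same marks, and
the vertices of the reduced instance are numbered in the order of `kept`, so the printed matrix is
the adjacency matrix of the induced graph. -/
theorem encode_reduced (x : SplitCRCSInstance) :
    x.reduced.encode = (encodeNat x.toInstance.numColors).map some ++
      none :: encodeList (restrictMarked
        (marks ((List.finRange x.numVertices).map x.record).reverse)
        ((List.finRange x.numVertices).map x.record).reverse
        (marks ((List.finRange x.numVertices).map x.record).reverse)) := by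
  classical
  have hrec : (List.finRange x.reduced.numVertices).map x.reduced.record =
      x.kept.map fun v => ⟨x.kept.map fun w => decide (x.toInstance.graph.Adj v w),
        (x.record v).source, (x.record v).target⟩ := by
    have hk : x.kept = (List.finRange x.kept.length).map x.keptEmbedding :=
      (List.map_get_finRange x.kept).symm
    conv_rhs => rw [hk, List.map_map]
    refine List.map_congr_left fun i _ => ?_
    simp only [Function.comp, record, VertexRecord.mk.injEq]
    refine ⟨?_, rfl, rfl⟩
    rw [List.map_map, List.ofFn_eq_map]
    refine List.map_congr_left fun j _ => ?_
    simp only [Function.comp, decide_eq_decide]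
    exact Iff.rfl
  rw [encode_eq, hrec, ← List.map_reverse, restrictMarked_map]
  refine congrArg (fun l => (encodeNat x.toInstance.numColors).map some ++
    none :: encodeList l) (List.map_congr_left fun v _ => ?_)
  simp only [VertexRecord.mk.injEq, and_true]
  rw [kept, ← selectMarked_map]
  simp only [record, List.ofFn_eq_map, List.map_reverse]

theorem polyTime_kernel :
    Nonempty (Turing.TM2ComputableInPolyTime encode encode kernel) := by
  open Polynomial in
  refine StackProg.nonempty_polyTime (KernelProg.kernelProg negative.encode) Stk.inp
    ((X + 1) * ((X + 1) * (50 * (X + 1) + 2) + 50 * (X + 1) + 2) +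
      (X + 1) * (12 * (X + 1) + 22) + 100 * (X + 1) + C negative.encode.length) fun x => ?_
  have stk : ∀ l : List (Option Bool),
      Function.update (fun _ => []) Stk.inp l = Stacks.get { inp := l } := by
    intro l
    funext k
    cases k <;> rfl
  have h := KernelProg.runs_kernelProg negative.encode (encodeNat x.toInstance.numColors)
    ((List.finRange x.numVertices).map x.record) (by
      intro r hr
      obtain ⟨v, _, rfl⟩ := List.mem_map.1 hr
      simp [record])
  rw [← encode_eq, ← encode_reduced] at h
  rw [stk, stk]
  refine h.cast ?_ ?_
  · by_cases hx : x.TwinsFixed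
    · rw [kernel, if_pos hx, if_pos (x.badCount_records_eq_zero_iff.2 hx)]
    · rw [kernel, if_neg hx, if_neg (mt x.badCount_records_eq_zero_iff.1 hx)]
  · simp [KernelProg.timeBound]

end SplitCRCSInstance

/-! ### The kernelization and the main theorem. -/

theorem isKernelization_kernel : splitCRCS.IsKernelization SplitCRCSInstance.kernel where
  polyTime := SplitCRCSInstance.polyTime_kernel
  equivalent := SplitCRCSInstance.isYes_kernel_iff
  size_le := by
    -- This is the bound of `length_encode_le` with `k + 2` colors and the bound on the vertices
    -- inserted, plus the new parameter; `k + 2` leaves room for the two colors of the negative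
    -- instance.
    refine ⟨fun k => (k + 2 + 1 + (k + 2 * k * 2 ^ k) * (k + 2 * k * 2 ^ k + 2 * (k + 2) + 3)) +
      (k + 2), ?_, fun x => ?_⟩
    · have hpow : Primrec₂ fun a b : ℕ => a ^ b := Primrec₂.unpaired'.1 Nat.Primrec.pow
      have hid : Primrec fun k : ℕ => k := Primrec.id
      have hadd {f g : ℕ → ℕ} (hf : Primrec f) (hg : Primrec g) : Primrec fun k => f k + g k :=
        Primrec.nat_add.comp hf hg
      have hmul {f g : ℕ → ℕ} (hf : Primrec f) (hg : Primrec g) : Primrec fun k => f k * g k :=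
        Primrec.nat_mul.comp hf hg
      have hc (c : ℕ) : Primrec fun _ : ℕ => c := Primrec.const c
      have hB : Primrec fun k : ℕ => k + 2 * k * 2 ^ k :=
        hadd hid (hmul (hmul (hc 2) hid) (hpow.comp (hc 2) hid))
      exact (hadd (hadd (hadd (hadd hid (hc 2)) (hc 1)) (hmul hB (hadd (hadd hB
        (hmul (hc 2) (hadd hid (hc 2)))) (hc 3)))) (hadd hid (hc 2))).to_comp
    · have h1 := x.numVertices_kernel_le
      have h2 := x.numColors_kernel_le
      have h3 := x.kernel.length_encode_le
      refine add_le_add (h3.trans (add_le_add (by simpa [splitCRCS] using h2)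
        (Nat.mul_le_mul h1 ?_))) h2
      simp only [splitCRCS]
      omega

theorem mainTheorem8 :
    -- the first reduction rule is safe
    (∀ (V : Type u) [Finite V] (x : CRCSInstance V) (C I : Set V),
      IsSplitPartition x.graph C I → ∀ a b : V, x.Rule1Applies I a b → ¬ x.IsYes) ∧
    -- the second reduction rule is safe, once the first one cannot be applied
    (∀ (V : Type u) [Finite V] (x : CRCSInstance V) (C I : Set V),
      IsSplitPartition x.graph C I → (∀ a b : V, ¬ x.Rule1Applies I a b) →
      ∀ a b w : V, x.Rule2Applies I a b w →
        IsSplitPartition (x.deleteVertex w).graph (Subtype.val ⁻¹' C) (Subtype.val ⁻¹' I) ∧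
        (x.IsValid → (x.deleteVertex w).IsValid) ∧
        ((x.deleteVertex w).IsYes ↔ x.IsYes)) ∧
    -- there is a kernel with at most `k + 2k * 2^k` vertices
    (∃ K : SplitCRCSInstance → SplitCRCSInstance,
      splitCRCS.IsKernelization K ∧
      (∀ x, x.toInstance.IsValid → (K x).toInstance.IsValid) ∧
      ∀ x, (K x).numVertices ≤
        x.toInstance.numColors + 2 * x.toInstance.numColors * 2 ^ x.toInstance.numColors) := by
  refine ⟨fun V _ x C I _ a b h => ?_, fun V _ x C I hCI h1 a b w h => ?_,
    SplitCRCSInstance.kernel, isKernelization_kernel, SplitCRCSInstance.isValid_kernel,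
    SplitCRCSInstance.numVertices_kernel_le⟩
  · obtain ⟨_, _, hab, hN, hs, ht⟩ := h
    exact x.not_isYes_of_twin hab hN hs ht
  · obtain ⟨ha, hb, hw, hab, haw, hbw, hN, hN', hs, hs'⟩ := h
    rw [x.deleteVertex_eq_restrict]
    have hfix : ∀ v ∉ Set.range (Function.Embedding.subtype (· ∈ ({w}ᶜ : Set V))),
        x.source v = x.target v := by
      intro v hv
      obtain rfl := CRCSInstance.notMem_range_subtype_compl hv
      by_contra hne
      -- A color change at the deleted vertex would make the first rule applicable to it and its
      -- twin `b`.
      exact h1 b v ⟨hb, hw, hbw, hN', hs', Or.inr hne⟩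
    refine ⟨x.isSplitPartition_restrict _ hCI, x.isValid_restrict _ hfix,
      x.isYes_restrict_iff _ (fun v hv => ?_) hfix⟩
    obtain rfl := CRCSInstance.notMem_range_subtype_compl hv
    exact ⟨⟨a, haw⟩, ⟨b, hbw⟩, fun h => hab (congrArg Subtype.val h), hN.trans hN', hN',
      hs.trans hs', hs'⟩
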